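/- Let $X\in\mathbb R^p$ and $Y\in\mathbb R^q$ be jointly distributed random vectors with $\mathbb E\|X\|<\infty$ and $\mathbb E\|Y\|<\infty$, and let $\phi_{X,Y}(s,t)=\mathbb E\,e^{i\langle s,X\rangle+i\langle t,Y\rangle}$, $\phi_X(s)=\phi_{X,Y}(s,0)$, $\phi_Y(t)=\phi_{X,Y}(0,t)$. With $c_p=\pi^{(p+1)/2}/\Gamma((p+1)/2)$, the squared distance covariance is $$\mathcal V^2(X,Y)=\frac1{c_pc_q}\int_{\mathbb R^p}\int_{\mathbb R^q}\frac{|\phi_{X,Y}(s,t)-\phi_X(s)\phi_Y(t)|^2}{\|s\|^{p+1}\|t\|^{q+1}}\,dt\,ds .$$ Define the symmetric kernel $$h\big((x_1,y_1),\ldots,(x_4,y_4)\big)=\frac1{24}\sum\big(\|x_i-x_j\|\|y_i-y_j\|-2\|x_i-x_j\|\|y_i-y_k\|+\|x_i-x_j\|\|y_k-y_l\|\big),$$ where the sum is over all distinct $i,j,k,l\in\{1,2,3,4\}$. Let $(X_1,Y_1),(X_2,Y_2),\ldots$ be i.i.d. copies of $(X,Y)$, let $$h_1(x,y)=\mathbb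 E\,h\big((x,y),(X_2,Y_2),(X_3,Y_3),(X_4,Y_4)\big),$$ and let $$\widehat\Omega=\binom n4^{-1}\sum_{1\le i<j<k<l\le n}h\big((X_i,Y_i),(X_j,Y_j),(X_k,Y_k),(X_l,Y_l)\big).$$ Suppose that $\mathbb E\,h\big((X_1,Y_1),\ldots,(X_4,Y_4)\big)^2<\infty$ and $0<\mathrm{Var}(h_1(X,Y))<\infty$. Then $\mathcal V^2(X,Y)<\infty$, and, as $n\to\infty$, $\sqrt n\,\big(\widehat\Omega-\mathcal V^2(X,Y)\big)$ converges in distribution to $Z$, where $Z\sim\mathcal N\big(0,16\,\mathrm{Var}(h_1(X,Y))\big)$. -/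

import Mathlib

open MeasureTheory ProbabilityTheory Filter Topology
open scoped ENNReal

noncomputable section

namespace DistCov

/-- The normalizing constant `c_p = π^((p+1)/2) / Γ((p+1)/2)`. -/
def normConst (p : ℕ) : ℝ :=
  Real.pi ^ (((p : ℝ) + 1) / 2) / Real.Gamma (((p : ℝ) + 1) / 2)

/-- The joint characteristic function
`φ_{X,Y}(s,t) = E exp(i⟨s,X⟩ + i⟨t,Y⟩)` of two random vectors. -/
def jointCharFun {Ω : Type*} [MeasurableSpace Ω] {p q : ℕ} (P : Measure Ω)
    (X : Ω → EuclideanSpace ℝ (Fin p)) (Y : Ω → EuclideanSpace ℝ (Fin q))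
    (s : EuclideanSpace ℝ (Fin p)) (t : EuclideanSpace ℝ (Fin q)) : ℂ :=
  ∫ ω, Complex.exp (Complex.I * ((inner ℝ s (X ω) : ℝ) : ℂ)
    + Complex.I * ((inner ℝ t (Y ω) : ℝ) : ℂ)) ∂P

/-- The squared distance covariance `𝒱²(X,Y)`, as a number in `[0,∞]`:
`(c_p c_q)⁻¹ ∫∫ |φ_{X,Y}(s,t) - φ_X(s) φ_Y(t)|² / (‖s‖^(p+1) ‖t‖^(q+1)) ds dt`. -/
def dcovSq {Ω : Type*} [MeasurableSpace Ω] {p q : ℕ} (P : Measure Ω)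
    (X : Ω → EuclideanSpace ℝ (Fin p)) (Y : Ω → EuclideanSpace ℝ (Fin q)) : ℝ≥0∞ :=
  ENNReal.ofReal (1 / (normConst p * normConst q)) *
    ∫⁻ s : EuclideanSpace ℝ (Fin p), ∫⁻ t : EuclideanSpace ℝ (Fin q),
      ENNReal.ofReal
        (‖jointCharFun P X Y s t - jointCharFun P X Y s 0 * jointCharFun P X Y 0 t‖ ^ 2
          / (‖s‖ ^ (p + 1) * ‖t‖ ^ (q + 1)))

/-- The symmetric kernel `h` of order 4. The sum over distinct `i, j, k, l` is a sum over the
permutations `σ` of four indices, with `(i, j, k, l) = (σ 0, σ 1, σ 2, σ 3)`. -/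
def kernel {p q : ℕ} (z : Fin 4 → EuclideanSpace ℝ (Fin p) × EuclideanSpace ℝ (Fin q)) : ℝ :=
  (1 / 24) * ∑ σ : Equiv.Perm (Fin 4),
    (‖(z (σ 0)).1 - (z (σ 1)).1‖ * ‖(z (σ 0)).2 - (z (σ 1)).2‖
      - 2 * (‖(z (σ 0)).1 - (z (σ 1)).1‖ * ‖(z (σ 0)).2 - (z (σ 2)).2‖)
      + ‖(z (σ 0)).1 - (z (σ 1)).1‖ * ‖(z (σ 2)).2 - (z (σ 3)).2‖)

/-- The first projection `h₁(z) = E h(z, Z₂, Z₃, Z₄)`, where `Z₂, Z₃, Z₄` are independent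
with law `μ`. -/
def kernelProj {p q : ℕ} (μ : Measure (EuclideanSpace ℝ (Fin p) × EuclideanSpace ℝ (Fin q)))
    (z : EuclideanSpace ℝ (Fin p) × EuclideanSpace ℝ (Fin q)) : ℝ :=
  ∫ w : Fin 3 → EuclideanSpace ℝ (Fin p) × EuclideanSpace ℝ (Fin q),
    kernel (Fin.cons z w : Fin 4 → EuclideanSpace ℝ (Fin p) × EuclideanSpace ℝ (Fin q))
    ∂(Measure.pi fun _ => μ)

open Classical in
/-- The U-statistic `Ω̂` of a sample of size `n`: the average of `h` over all index quadruples
`i < j < k < l`, given as strictly increasing maps `Fin 4 → Fin n`. -/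
def uStat {p q : ℕ} (n : ℕ)
    (z : Fin n → EuclideanSpace ℝ (Fin p) × EuclideanSpace ℝ (Fin q)) : ℝ :=
  ((n.choose 4 : ℕ) : ℝ)⁻¹ *
    ∑ τ ∈ Finset.univ.filter (fun τ : Fin 4 → Fin n => StrictMono τ), kernel (fun a => z (τ a))

end DistCov

end

set_option linter.unusedSectionVars false

/-! The proof has two halves: the squared distance covariance is the mean of the kernel, and a
U-statistic with square integrable kernel obeys a central limit theorem.

For the first half, `1 - cos⟨t,x⟩` integrates to `c_p ‖x‖` against the weight `‖t‖ ^ -(p+1)`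
(`lintegral_one_sub_cos_div`). For two independent copies of the pair, the mean of `(e^{i⟨s,X⟩} -
e^{i⟨s,X'⟩}) (e^{i⟨t,Y⟩} - e^{i⟨t,Y'⟩})` is `2 (φ_{X,Y} - φ_X φ_Y)`. Its squared modulus is
therefore a mean over four independent copies, and Fubini lets the frequencies be integrated first,
which turns waves into distances (`integral_waveProd_left`, `integral_waveProd_right`). The result
is `dcovSq_eq`: a quarter of the mean of a product of mixed second differences of the two distances.
Symmetrizing that product over four points gives the kernel (`kernel_eq_sum_distDiff`).

For the second half, Hoeffding's decomposition (`uStatistic_sub_mean`) writes the centred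
U-statistic as an i.i.d. average of its first projections plus a U-statistic whose kernel has
vanishing conditional means given one argument. Terms of the latter that share at most one index are
uncorrelated, so its second moment is `O(n⁻²)` (`integral_uStatistic_sq_le`). It disappears at scale
`√n`, and the classical central limit theorem with Slutsky's lemma finishes. The factor 16 is the
square of the order 4. -/

namespace DistCov

/-! ### The norm as an integral of `1 - cos`. -/

/-- A non-integrable function has Bochner integral 0, so the positive value given by the Gamma
integral forces integrability. -/
lemma integrableOn_rpow_mul_exp_neg_mul {a r : ℝ} (ha : 0 < a) (hr : 0 < r) :
    IntegrableOn (fun u : ℝ => u ^ (a - 1) * Real.exp (-(r * u))) (Set.Ioi 0) := by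
  by_contra h
  have h1 := Real.integral_rpow_mul_exp_neg_mul_Ioi ha hr
  rw [integral_undef h] at h1
  have : 0 < (1 / r) ^ a * Real.Gamma a :=
    mul_pos (Real.rpow_pos_of_pos (by positivity) _) (Real.Gamma_pos_of_pos ha)
  linarith

lemma lintegral_rpow_mul_exp_neg_mul {a r : ℝ} (ha : 0 < a) (hr : 0 < r) :
    ∫⁻ u in Set.Ioi (0 : ℝ), ENNReal.ofReal (u ^ (a - 1) * Real.exp (-(r * u))) =
      ENNReal.ofReal ((1 / r) ^ a * Real.Gamma a) := by
  rw [← Real.integral_rpow_mul_exp_neg_mul_Ioi ha hr, ofReal_integral_eq_lintegral_ofReal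
    (integrableOn_rpow_mul_exp_neg_mul ha hr)]
  filter_upwards [ae_restrict_mem measurableSet_Ioi] with u hu
  have : (0 : ℝ) < u := hu
  simp only [Pi.zero_apply]; positivity

/-- The substitution `u ↦ u⁻¹` reduces this to the Gamma integral with exponent `1/2`, and `Γ(1/2) =
√π`. -/
lemma lintegral_rpow_mul_exp_neg_div {s : ℝ} (hs : 0 < s) :
    ∫⁻ u in Set.Ioi (0 : ℝ), ENNReal.ofReal (u ^ (-(3 / 2) : ℝ) * Real.exp (-(s / u))) =
      ENNReal.ofReal (√Real.pi * s ^ (-(1 / 2) : ℝ)) := by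
  set g : ℝ → ℝ := fun v => v ^ ((1 / 2 : ℝ) - 1) * Real.exp (-(s * v)) with hg
  have hgi : IntegrableOn g (Set.Ioi 0) :=
    integrableOn_rpow_mul_exp_neg_mul (by norm_num) hs
  have hEq : Set.EqOn (fun x : ℝ => (|(-1 : ℝ)| * x ^ ((-1 : ℝ) - 1)) • g (x ^ (-1 : ℝ)))
      (fun u => u ^ (-(3 / 2) : ℝ) * Real.exp (-(s / u))) (Set.Ioi 0) := by
    intro u hu
    have hu : (0 : ℝ) < u := hu
    simp only [hg, smul_eq_mul]
    rw [← Real.rpow_mul hu.le, ← mul_assoc, abs_neg, abs_one, one_mul, ← Real.rpow_add hu,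
      Real.rpow_neg_one, div_eq_mul_inv]
    norm_num [div_eq_mul_inv]
  have hint := (integrableOn_Ioi_comp_rpow_iff g (by norm_num : (-1 : ℝ) ≠ 0)).2 hgi
  have hval := integral_comp_rpow_Ioi g (by norm_num : (-1 : ℝ) ≠ 0)
  rw [integrableOn_congr_fun hEq measurableSet_Ioi] at hint
  rw [setIntegral_congr_fun measurableSet_Ioi hEq, hg,
    Real.integral_rpow_mul_exp_neg_mul_Ioi (by norm_num) hs, Real.Gamma_one_half_eq] at hval
  rw [← ofReal_integral_eq_lintegral_ofReal hint, hval]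
  · rw [mul_comm, one_div, Real.inv_rpow hs.le, Real.rpow_neg hs.le]
  · filter_upwards [ae_restrict_mem measurableSet_Ioi] with u hu
    have : (0 : ℝ) < u := hu
    simp only [Pi.zero_apply]; positivity

lemma one_sub_exp_neg_div {c u : ℝ} (hc : 0 ≤ c) (hu : 0 < u) :
    ENNReal.ofReal (1 - Real.exp (-(c / u))) =
      ∫⁻ s in Set.Ioc 0 c, ENNReal.ofReal (u⁻¹ * Real.exp (-(s / u))) := by
  have hd : ∀ s ∈ Set.uIcc 0 c,
      HasDerivAt (fun s => -Real.exp (-(s / u))) (u⁻¹ * Real.exp (-(s / u))) s := by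
    intro s _
    have := (((hasDerivAt_id s).div_const u).neg.exp).neg
    convert! this using 1
    simp [mul_comm]
  have hcont : Continuous fun s : ℝ => u⁻¹ * Real.exp (-(s / u)) := by fun_prop
  have h := intervalIntegral.integral_eq_sub_of_hasDerivAt hd (hcont.intervalIntegrable _ _)
  rw [intervalIntegral.integral_of_le hc] at h
  rw [← ofReal_integral_eq_lintegral_ofReal, h]
  · simp; ring_nf
  · exact (hcont.integrableOn_Icc).mono_set Set.Ioc_subset_Icc_self
  · filter_upwards with s
    simp only [Pi.zero_apply]; positivity

/-- Writing `1 - e^{-c/u}` as an integral over `s ∈ (0, c]` and exchanging the integrals leaves `√π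
∫₀^c s^{-1/2} ds`. -/
lemma lintegral_rpow_mul_one_sub_exp {c : ℝ} (hc : 0 ≤ c) :
    ∫⁻ u in Set.Ioi (0 : ℝ), ENNReal.ofReal (u ^ (-(1 / 2) : ℝ) * (1 - Real.exp (-(c / u)))) =
      ENNReal.ofReal (2 * √Real.pi * √c) := by
  have h1 : ∀ u ∈ Set.Ioi (0 : ℝ),
      ENNReal.ofReal (u ^ (-(1 / 2) : ℝ) * (1 - Real.exp (-(c / u)))) =
      ∫⁻ s in Set.Ioc 0 c, ENNReal.ofReal (u ^ (-(3 / 2) : ℝ) * Real.exp (-(s / u))) := by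
    intro u hu
    have hu : (0 : ℝ) < u := hu
    rw [ENNReal.ofReal_mul (by positivity), one_sub_exp_neg_div hc hu,
      ← lintegral_const_mul _ (by fun_prop)]
    congr 1 with s
    rw [← ENNReal.ofReal_mul (by positivity), ← mul_assoc, ← Real.rpow_neg_one,
      ← Real.rpow_add hu]
    norm_num
  rw [setLIntegral_congr_fun measurableSet_Ioi h1, lintegral_lintegral_swap (by fun_prop)]
  have h2 : ∀ s ∈ Set.Ioc (0 : ℝ) c,
      ∫⁻ u in Set.Ioi (0 : ℝ), ENNReal.ofReal (u ^ (-(3 / 2) : ℝ) * Real.exp (-(s / u))) =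
      ENNReal.ofReal (√Real.pi * s ^ (-(1 / 2) : ℝ)) :=
    fun s hs => lintegral_rpow_mul_exp_neg_div hs.1
  rw [setLIntegral_congr_fun measurableSet_Ioc h2, ← ofReal_integral_eq_lintegral_ofReal]
  · rw [integral_const_mul, ← intervalIntegral.integral_of_le hc,
      integral_rpow (Or.inl (by norm_num)), Real.sqrt_eq_rpow c]
    congr 1
    rw [show (-(1 / 2) : ℝ) + 1 = 1 / 2 by norm_num, Real.zero_rpow (by norm_num)]
    ring
  · have := (intervalIntegral.intervalIntegrable_rpow' (a := 0) (b := c)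
      (r := (-(1 / 2) : ℝ)) (by norm_num)).const_mul √Real.pi
    exact (intervalIntegrable_iff_integrableOn_Ioc_of_le hc).1 this
  · filter_upwards [ae_restrict_mem measurableSet_Ioc] with s hs
    have := hs.1
    simp only [Pi.zero_apply]; positivity

lemma normConst_pos (p : ℕ) : 0 < normConst p :=
  div_pos (Real.rpow_pos_of_pos Real.pi_pos _) (Real.Gamma_pos_of_pos (by positivity))

section
variable {p : ℕ}

lemma integrable_exp_neg_mul_sq_norm {u : ℝ} (hu : 0 < u) :
    Integrable fun t : EuclideanSpace ℝ (Fin p) => Real.exp (-u * ‖t‖ ^ 2) := by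
  have := GaussianFourier.integrable_cexp_neg_mul_sq_norm_add (V := EuclideanSpace ℝ (Fin p))
    (b := (u : ℂ))
    (by simpa using hu) 0 0
  have h := this.norm
  refine h.congr (ae_of_all _ fun t => ?_)
  simp [Complex.norm_exp, ← Complex.ofReal_pow]

/-- The cosine part is the real part of the Fourier transform of a Gaussian. -/
lemma lintegral_exp_mul_one_sub_cos {u : ℝ} (hu : 0 < u) (x : EuclideanSpace ℝ (Fin p)) :
    ∫⁻ t : EuclideanSpace ℝ (Fin p),
        ENNReal.ofReal (Real.exp (-u * ‖t‖ ^ 2) * (1 - Real.cos (inner ℝ t x))) =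
      ENNReal.ofReal ((Real.pi / u) ^ ((p : ℝ) / 2) * (1 - Real.exp (-(‖x‖ ^ 2 / 4 / u)))) := by
  have hi := integrable_exp_neg_mul_sq_norm (p := p) hu
  have hic : Integrable fun t : EuclideanSpace ℝ (Fin p) =>
      Real.exp (-u * ‖t‖ ^ 2) * Real.cos (inner ℝ t x) := by
    refine hi.mul_bdd (c := 1) (Continuous.aestronglyMeasurable (by fun_prop))
      (ae_of_all _ fun t => ?_)
    simpa using Real.abs_cos_le_one _
  have hb : 0 < (u : ℂ).re := by simpa using hu
  have e1 : ∫ t : EuclideanSpace ℝ (Fin p), Real.exp (-u * ‖t‖ ^ 2) =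
      (Real.pi / u) ^ ((p : ℝ) / 2) := by
    simpa using GaussianFourier.integral_rexp_neg_mul_sq_norm (V := EuclideanSpace ℝ (Fin p)) hu
  have e2 : ∫ t : EuclideanSpace ℝ (Fin p), Real.exp (-u * ‖t‖ ^ 2) * Real.cos (inner ℝ t x) =
      (Real.pi / u) ^ ((p : ℝ) / 2) * Real.exp (-(‖x‖ ^ 2 / 4 / u)) := by
    have h := GaussianFourier.integral_cexp_neg_mul_sq_norm_add (V := EuclideanSpace ℝ (Fin p))
      hb Complex.I x
    have hint := GaussianFourier.integrable_cexp_neg_mul_sq_norm_add (V := EuclideanSpace ℝ (Fin p))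
      hb Complex.I x
    have h' := congrArg Complex.re h
    rw [← RCLike.re_eq_complex_re, ← integral_re hint] at h'
    convert! h' using 1
    · congr 1 with t
      simp [Complex.exp_re, ← Complex.ofReal_pow, real_inner_comm]
    · have : (Real.pi / u : ℂ) ^ ((Module.finrank ℝ (EuclideanSpace ℝ (Fin p)) : ℂ) / 2) *
          Complex.exp (Complex.I ^ 2 * ‖x‖ ^ 2 / (4 * u)) =
          (((Real.pi / u) ^ ((p : ℝ) / 2) * Real.exp (-(‖x‖ ^ 2 / 4 / u)) : ℝ) : ℂ) := by
        push_cast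
        rw [Complex.ofReal_cpow (by positivity)]
        simp only [finrank_euclideanSpace, Fintype.card_fin, Complex.I_sq]
        push_cast
        congr 2
        field_simp
      rw [this, RCLike.re_eq_complex_re, Complex.ofReal_re]
  rw [← ofReal_integral_eq_lintegral_ofReal]
  · simp_rw [mul_sub, mul_one]
    rw [integral_sub hi hic, e1, e2]
  · simp_rw [mul_sub, mul_one]
    exact hi.sub hic
  · filter_upwards with t
    have := Real.cos_le_one (inner ℝ t x)
    exact mul_nonneg (by positivity) (by linarith)

/-- The Gamma integral represents `‖t‖ ^ -(p+1)` as a mixture of Gaussians, which makes the integral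
over `t` explicit once the order of integration is exchanged. -/
lemma ofReal_one_sub_cos_div (t x : EuclideanSpace ℝ (Fin p)) :
    ENNReal.ofReal ((1 - Real.cos (inner ℝ t x)) / ‖t‖ ^ (p + 1)) =
      ENNReal.ofReal (Real.Gamma (((p : ℝ) + 1) / 2))⁻¹ * ∫⁻ u in Set.Ioi (0 : ℝ),
        ENNReal.ofReal (u ^ (((p : ℝ) + 1) / 2 - 1)) *
        ENNReal.ofReal (Real.exp (-u * ‖t‖ ^ 2) * (1 - Real.cos (inner ℝ t x))) := by
  rcases eq_or_ne t 0 with rfl | ht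
  · simp
  have hc : 0 ≤ 1 - Real.cos (inner ℝ t x) := by linarith [Real.cos_le_one (inner ℝ t x)]
  have ht' : 0 < ‖t‖ := norm_pos_iff.2 ht
  have ha : 0 < ((p : ℝ) + 1) / 2 := by positivity
  have hG := Real.Gamma_pos_of_pos ha
  have h1 : ∀ u ∈ Set.Ioi (0 : ℝ), ENNReal.ofReal (u ^ (((p : ℝ) + 1) / 2 - 1)) *
      ENNReal.ofReal (Real.exp (-u * ‖t‖ ^ 2) * (1 - Real.cos (inner ℝ t x))) =
      ENNReal.ofReal (1 - Real.cos (inner ℝ t x)) *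
      ENNReal.ofReal (u ^ (((p : ℝ) + 1) / 2 - 1) * Real.exp (-(‖t‖ ^ 2 * u))) := by
    intro u hu
    have hu : (0 : ℝ) < u := hu
    rw [← ENNReal.ofReal_mul (by positivity), ← ENNReal.ofReal_mul hc]
    congr 1
    rw [mul_comm (‖t‖ ^ 2), neg_mul]
    ring
  rw [setLIntegral_congr_fun measurableSet_Ioi h1, lintegral_const_mul _ (by fun_prop),
    lintegral_rpow_mul_exp_neg_mul ha (by positivity), ← ENNReal.ofReal_mul hc,
    ← ENNReal.ofReal_mul (by positivity)]
  congr 1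
  have : (1 / ‖t‖ ^ 2) ^ (((p : ℝ) + 1) / 2) = (‖t‖ ^ (p + 1))⁻¹ := by
    rw [one_div, Real.inv_rpow (by positivity), ← Real.rpow_natCast, ← Real.rpow_mul ht'.le,
      ← Real.rpow_natCast]
    congr 2
    push_cast; ring
  rw [this]
  field_simp

/-- The distance as an integral of `1 - cos` against the weight `‖t‖ ^ -(p+1)`. -/
lemma lintegral_one_sub_cos_div (x : EuclideanSpace ℝ (Fin p)) :
    ∫⁻ t : EuclideanSpace ℝ (Fin p), ENNReal.ofReal ((1 - Real.cos (inner ℝ t x)) / ‖t‖ ^ (p + 1)) =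
      ENNReal.ofReal (normConst p * ‖x‖) := by
  have ha : 0 < ((p : ℝ) + 1) / 2 := by positivity
  have hG := Real.Gamma_pos_of_pos ha
  simp_rw [ofReal_one_sub_cos_div]
  rw [lintegral_const_mul' _ _ (by finiteness), lintegral_lintegral_swap (by fun_prop)]
  have h1 : ∀ u ∈ Set.Ioi (0 : ℝ), ∫⁻ t : EuclideanSpace ℝ (Fin p),
      ENNReal.ofReal (u ^ (((p : ℝ) + 1) / 2 - 1)) *
      ENNReal.ofReal (Real.exp (-u * ‖t‖ ^ 2) * (1 - Real.cos (inner ℝ t x))) =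
      ENNReal.ofReal (Real.pi ^ ((p : ℝ) / 2)) *
      ENNReal.ofReal (u ^ (-(1 / 2) : ℝ) * (1 - Real.exp (-(‖x‖ ^ 2 / 4 / u)))) := by
    intro u hu
    have hu : (0 : ℝ) < u := hu
    rw [lintegral_const_mul _ (by fun_prop), lintegral_exp_mul_one_sub_cos hu,
      ← ENNReal.ofReal_mul (by positivity), ← ENNReal.ofReal_mul (by positivity),
      Real.div_rpow Real.pi_pos.le hu.le]
    congr 1
    -- The Gaussian contributes `u ^ (-p/2)`, so the exponent of `u` no longer depends on the
    -- dimension.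
    have : u ^ (-(1 / 2) : ℝ) = u ^ (((p : ℝ) + 1) / 2 - 1) / u ^ ((p : ℝ) / 2) := by
      rw [← Real.rpow_sub hu]; congr 1; ring
    rw [this]; ring
  rw [setLIntegral_congr_fun measurableSet_Ioi h1, lintegral_const_mul _ (by fun_prop),
    lintegral_rpow_mul_one_sub_exp (by positivity), ← ENNReal.ofReal_mul (by positivity),
    ← ENNReal.ofReal_mul (by positivity)]
  congr 1
  have e1 : √(‖x‖ ^ 2 / 4) = ‖x‖ / 2 := by
    rw [show ‖x‖ ^ 2 / 4 = (‖x‖ / 2) ^ 2 by ring, Real.sqrt_sq (by positivity)]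
  have e2 : Real.pi ^ (((p : ℝ) + 1) / 2) = Real.pi ^ ((p : ℝ) / 2) * √Real.pi := by
    rw [Real.sqrt_eq_rpow, ← Real.rpow_add Real.pi_pos]; congr 1; ring
  rw [e1, normConst, e2]
  field_simp

end

end DistCov

/-! ### Plane waves integrated against the singular weight. -/

namespace DistCov

open scoped ComplexConjugate

section Wave
variable {V : Type*} [NormedAddCommGroup V] [InnerProductSpace ℝ V]

/-- The plane wave `x ↦ exp(i⟨s,x⟩)`. -/
noncomputable def wave (s x : V) : ℂ := Complex.exp (Complex.I * ((inner ℝ s x : ℝ) : ℂ))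

/-- The difference of the plane wave at two points. -/
noncomputable def waveDiff (s : V) (u : V × V) : ℂ := wave s u.1 - wave s u.2

/-- The mixed second difference of the distance, taken at two pairs of points. -/
def distDiff (u v : V × V) : ℝ := ‖u.1 - v.1‖ - ‖u.1 - v.2‖ - ‖u.2 - v.1‖ + ‖u.2 - v.2‖

lemma norm_wave (s x : V) : ‖wave s x‖ = 1 := by
  simp [wave, Complex.norm_exp]

lemma wave_zero_left (x : V) : wave 0 x = 1 := by simp [wave]

lemma conj_wave (s x : V) : conj (wave s x) = wave (-s) x := by
  simp [wave, ← Complex.exp_conj]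

lemma conj_waveDiff (s : V) (u : V × V) : conj (waveDiff s u) = waveDiff (-s) u := by
  simp [waveDiff, conj_wave]

@[fun_prop]
lemma _root_.Measurable.wave [MeasurableSpace V] [BorelSpace V] [SecondCountableTopology V]
    {α : Type*} [MeasurableSpace α] {f g : α → V} (hf : Measurable f) (hg : Measurable g) :
    Measurable fun a => wave (f a) (g a) := by
  unfold DistCov.wave; fun_prop

@[fun_prop]
lemma _root_.Measurable.waveDiff [MeasurableSpace V] [BorelSpace V] [SecondCountableTopology V]
    {α : Type*} [MeasurableSpace α] {f : α → V} {g : α → V × V} (hf : Measurable f)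
    (hg : Measurable g) : Measurable fun a => waveDiff (f a) (g a) := by
  unfold DistCov.waveDiff; fun_prop

lemma re_wave_mul_conj (s x y : V) :
    (wave s x * conj (wave s y)).re = Real.cos (inner ℝ s (x - y)) := by
  rw [inner_sub_right, wave, wave, ← Complex.exp_conj, ← Complex.exp_add]
  rw [show Complex.I * ((inner ℝ s x : ℝ) : ℂ) + conj (Complex.I * ((inner ℝ s y : ℝ) : ℂ)) =
    (((inner ℝ s x - inner ℝ s y : ℝ)) : ℂ) * Complex.I by simp; ring]
  rw [Complex.exp_ofReal_mul_I_re]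

/-- The four signs cancel, so a 1 can be inserted in each term. This matters because each `1 - cos`
is integrable against `weight`. -/
lemma re_waveDiff_mul_conj (s : V) (u v : V × V) :
    (waveDiff s u * conj (waveDiff s v)).re =
      -((1 - Real.cos (inner ℝ s (u.1 - v.1))) - (1 - Real.cos (inner ℝ s (u.1 - v.2)))
        - (1 - Real.cos (inner ℝ s (u.2 - v.1))) + (1 - Real.cos (inner ℝ s (u.2 - v.2)))) := by
  have : waveDiff s u * conj (waveDiff s v) = wave s u.1 * conj (wave s v.1)
      - wave s u.1 * conj (wave s v.2) - wave s u.2 * conj (wave s v.1)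
      + wave s u.2 * conj (wave s v.2) := by
    simp only [waveDiff, map_sub]; ring
  rw [this]
  simp only [Complex.add_re, Complex.sub_re, re_wave_mul_conj]
  ring

lemma norm_waveDiff_sq (s : V) (u : V × V) :
    ‖waveDiff s u‖ ^ 2 = 2 * (1 - Real.cos (inner ℝ s (u.1 - u.2))) := by
  have h := re_waveDiff_mul_conj s u u
  rw [Complex.mul_conj, Complex.ofReal_re, Complex.normSq_eq_norm_sq] at h
  rw [h, ← neg_sub u.1 u.2, inner_neg_right, Real.cos_neg]
  simp; ring

end Wave

/-- The measure on `ℝ^p` with density `‖t‖ ^ -(p+1)`. -/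
noncomputable def weight (p : ℕ) : Measure (EuclideanSpace ℝ (Fin p)) :=
  volume.withDensity fun t => ENNReal.ofReal (1 / ‖t‖ ^ (p + 1))

instance (p : ℕ) : SFinite (weight p) := by unfold weight; infer_instance

section Weight
variable {p q : ℕ}

lemma lintegral_weight (f : EuclideanSpace ℝ (Fin p) → ℝ≥0∞) (hf : Measurable f) :
    ∫⁻ t, f t ∂weight p = ∫⁻ t, ENNReal.ofReal (1 / ‖t‖ ^ (p + 1)) * f t := by
  rw [weight, lintegral_withDensity_eq_lintegral_mul _ (by fun_prop) hf]
  rfl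

lemma measurePreserving_neg_weight (p : ℕ) :
    MeasurePreserving (fun t => -t) (weight p) (weight p) := by
  refine ⟨measurable_neg, ?_⟩
  ext s hs
  rw [Measure.map_apply measurable_neg hs, weight, withDensity_apply _ hs,
    withDensity_apply _ (measurable_neg hs), ← lintegral_indicator hs,
    ← lintegral_indicator (measurable_neg hs),
    ← lintegral_neg_eq_self (μ := (volume : Measure (EuclideanSpace ℝ (Fin p))))]
  congr 1 with t
  by_cases ht : t ∈ s
  · rw [Set.indicator_of_mem ht, Set.indicator_of_mem, norm_neg]
    change - -t ∈ s
    rwa [neg_neg]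
  · rw [Set.indicator_of_notMem ht, Set.indicator_of_notMem]
    change - -t ∉ s
    rwa [neg_neg]

lemma lintegral_one_sub_cos_weight (x : EuclideanSpace ℝ (Fin p)) :
    ∫⁻ t, ENNReal.ofReal (1 - Real.cos (inner ℝ t x)) ∂weight p =
      ENNReal.ofReal (normConst p * ‖x‖) := by
  rw [lintegral_weight _ (by fun_prop), ← lintegral_one_sub_cos_div]
  congr 1 with t
  rw [← ENNReal.ofReal_mul (by positivity)]
  congr 1; ring

lemma integrable_one_sub_cos (x : EuclideanSpace ℝ (Fin p)) :
    Integrable (fun t => 1 - Real.cos (inner ℝ t x)) (weight p) := by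
  refine ⟨Continuous.aestronglyMeasurable (by fun_prop), ?_⟩
  rw [hasFiniteIntegral_iff_ofReal (ae_of_all _ fun t => ?_), lintegral_one_sub_cos_weight]
  · finiteness
  · simpa using Real.cos_le_one _

lemma integral_one_sub_cos (x : EuclideanSpace ℝ (Fin p)) :
    ∫ t, (1 - Real.cos (inner ℝ t x)) ∂weight p = normConst p * ‖x‖ := by
  rw [integral_eq_lintegral_of_nonneg_ae (ae_of_all _ fun t => ?_)
    (Continuous.aestronglyMeasurable (by fun_prop)), lintegral_one_sub_cos_weight,
    ENNReal.toReal_ofReal (mul_nonneg (normConst_pos p).le (norm_nonneg _))]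
  simpa using Real.cos_le_one _

lemma lintegral_norm_waveDiff_sq (u : EuclideanSpace ℝ (Fin p) × EuclideanSpace ℝ (Fin p)) :
    ∫⁻ s, ENNReal.ofReal (‖waveDiff s u‖ ^ 2) ∂weight p =
      ENNReal.ofReal (2 * (normConst p * ‖u.1 - u.2‖)) := by
  simp_rw [norm_waveDiff_sq, ENNReal.ofReal_mul zero_le_two]
  rw [lintegral_const_mul _ (by fun_prop), lintegral_one_sub_cos_weight]

/-- By the inequality between arithmetic and geometric means, the product is dominated by the sum of
two functions `1 - cos`. -/
lemma integrable_waveDiff_mul_conj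
    (u v : EuclideanSpace ℝ (Fin p) × EuclideanSpace ℝ (Fin p)) :
    Integrable (fun s => waveDiff s u * conj (waveDiff s v)) (weight p) := by
  have hu := integrable_one_sub_cos (u.1 - u.2)
  have hv := integrable_one_sub_cos (v.1 - v.2)
  refine (hu.add hv).mono' (Measurable.aestronglyMeasurable ?_) (ae_of_all _ fun s => ?_)
  · simp only [conj_waveDiff]; fun_prop
  have h1 := norm_waveDiff_sq s u
  have h2 := norm_waveDiff_sq s v
  rw [norm_mul, RCLike.norm_conj]
  simp only [Pi.add_apply]
  nlinarith [sq_nonneg (‖waveDiff s u‖ - ‖waveDiff s v‖)]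

lemma integral_waveDiff_mul_conj
    (u v : EuclideanSpace ℝ (Fin p) × EuclideanSpace ℝ (Fin p)) :
    ∫ s, waveDiff s u * conj (waveDiff s v) ∂weight p =
      ((-(normConst p * distDiff u v) : ℝ) : ℂ) := by
  have hi := integrable_waveDiff_mul_conj u v
  -- The integral is real: conjugating the integrand replaces `s` by `-s`, and the weight is even.
  have him : conj (∫ s, waveDiff s u * conj (waveDiff s v) ∂weight p) =
      ∫ s, waveDiff s u * conj (waveDiff s v) ∂weight p := by
    rw [← integral_conj, ← (measurePreserving_neg_weight p).integral_comp
      (MeasurableEquiv.neg _).measurableEmbedding]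
    congr 1 with s
    simp [conj_waveDiff]
  rw [← Complex.conj_eq_iff_re.1 him]
  congr 1
  rw [← RCLike.re_eq_complex_re, ← integral_re hi]
  simp only [RCLike.re_eq_complex_re, re_waveDiff_mul_conj]
  have i := fun x : EuclideanSpace ℝ (Fin p) => integrable_one_sub_cos x
  have i2 := fun x y : EuclideanSpace ℝ (Fin p) => Integrable.sub' (i x) (i y)
  have i3 := fun x y z : EuclideanSpace ℝ (Fin p) => Integrable.sub' (i2 x y) (i z)
  rw [integral_neg, integral_add (i3 _ _ _) (i _), integral_sub (i2 _ _) (i _),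
    integral_sub (i _) (i _)]
  simp only [integral_one_sub_cos, distDiff]
  ring

end Weight

end DistCov

/-! ### Distance covariance as a mean over four independent copies. -/

namespace DistCov

open scoped ComplexConjugate

section Pair
variable {V W : Type*}

/-- The first components of a pair of points of a product. -/
def pairFst (a : (V × W) × (V × W)) : V × V := (a.1.1, a.2.1)

/-- The second components of a pair of points of a product. -/
def pairSnd (a : (V × W) × (V × W)) : W × W := (a.1.2, a.2.2)

variable [MeasurableSpace V] [MeasurableSpace W]

@[fun_prop]
lemma measurable_pairFst : Measurable (pairFst : (V × W) × (V × W) → V × V) := by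
  unfold pairFst; fun_prop

@[fun_prop]
lemma measurable_pairSnd : Measurable (pairSnd : (V × W) × (V × W) → W × W) := by
  unfold pairSnd; fun_prop

end Pair

section Law
variable {V W : Type*} [NormedAddCommGroup V] [InnerProductSpace ℝ V]
  [NormedAddCommGroup W] [InnerProductSpace ℝ W]

/-- The integrand of the squared distance covariance before taking expectations. -/
noncomputable def waveProd (r : (V × W) × (((V × W) × (V × W)) × ((V × W) × (V × W)))) : ℂ :=
  (waveDiff r.1.1 (pairFst r.2.1) * conj (waveDiff r.1.1 (pairFst r.2.2))) *
    (waveDiff r.1.2 (pairSnd r.2.1) * conj (waveDiff r.1.2 (pairSnd r.2.2)))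

/-- The pairing is crossed on purpose: each summand takes the first component from one pair and the
second from the other. These are independent, so the mean of the bound factors and first moments
suffice. -/
lemma enorm_waveProd_le (st : V × W) (a b : (V × W) × (V × W)) :
    ‖waveProd (st, (a, b))‖ₑ ≤
      ENNReal.ofReal (‖waveDiff st.1 (pairFst a)‖ ^ 2) *
        ENNReal.ofReal (‖waveDiff st.2 (pairSnd b)‖ ^ 2) +
      ENNReal.ofReal (‖waveDiff st.1 (pairFst b)‖ ^ 2) *
        ENNReal.ofReal (‖waveDiff st.2 (pairSnd a)‖ ^ 2) := by
  rw [← ENNReal.ofReal_mul (by positivity), ← ENNReal.ofReal_mul (by positivity),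
    ← ENNReal.ofReal_add (by positivity) (by positivity), ← ofReal_norm]
  refine ENNReal.ofReal_le_ofReal ?_
  simp only [waveProd, norm_mul, RCLike.norm_conj]
  nlinarith [two_mul_le_add_sq (‖waveDiff st.1 (pairFst a)‖ * ‖waveDiff st.2 (pairSnd b)‖)
    (‖waveDiff st.1 (pairFst b)‖ * ‖waveDiff st.2 (pairSnd a)‖),
    sq_nonneg (‖waveDiff st.1 (pairFst a)‖ * ‖waveDiff st.2 (pairSnd b)‖),
    sq_nonneg (‖waveDiff st.1 (pairFst b)‖ * ‖waveDiff st.2 (pairSnd a)‖)]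

variable [MeasurableSpace V] [BorelSpace V] [SecondCountableTopology V]
  [MeasurableSpace W] [BorelSpace W] [SecondCountableTopology W]

lemma measurable_waveProd : Measurable (waveProd (V := V) (W := W)) := by
  unfold waveProd
  simp only [conj_waveDiff]
  fun_prop

variable (μ : Measure (V × W))

/-- The characteristic function of a law on a product of two inner product spaces. -/
noncomputable def lawCharFun (s : V) (t : W) : ℂ := ∫ z, wave s z.1 * wave t z.2 ∂μ

variable [IsProbabilityMeasure μ]

@[fun_prop]
lemma _root_.Measurable.lawCharFun {α : Type*} [MeasurableSpace α] {f : α → V} {g : α → W}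
    (hf : Measurable f) (hg : Measurable g) : Measurable fun a => lawCharFun μ (f a) (g a) := by
  have : Measurable fun r : α × (V × W) => wave (f r.1) r.2.1 * wave (g r.1) r.2.2 := by
    fun_prop
  exact (this.stronglyMeasurable.integral_prod_right (ν := μ)).measurable

lemma integrable_wave_mul_wave (s : V) (t : W) :
    Integrable (fun z => wave s z.1 * wave t z.2) μ := by
  refine Integrable.of_bound (C := 1) (Measurable.aestronglyMeasurable (by fun_prop))
    (ae_of_all _ fun z => ?_)
  simp [norm_wave]

/-- Of the four terms of the product, the two unmixed ones give the joint characteristic function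
and the two mixed ones factor by independence. -/
lemma integral_waveDiff_mul_waveDiff (s : V) (t : W) :
    ∫ a, waveDiff s (pairFst a) * waveDiff t (pairSnd a) ∂(μ.prod μ) =
      2 * (lawCharFun μ s t - lawCharFun μ s 0 * lawCharFun μ 0 t) := by
  have hs : Integrable (fun z => wave s z.1) μ := by
    simpa [wave_zero_left] using integrable_wave_mul_wave μ s 0
  have ht : Integrable (fun z => wave t z.2) μ := by
    simpa [wave_zero_left] using integrable_wave_mul_wave μ 0 t
  have hst := integrable_wave_mul_wave μ s t
  have i1 : Integrable (fun a => wave s (Prod.fst a).1 * wave t (Prod.fst a).2) (μ.prod μ) :=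
    hst.comp_fst μ
  have i4 : Integrable (fun a => wave s (Prod.snd a).1 * wave t (Prod.snd a).2) (μ.prod μ) :=
    hst.comp_snd μ
  have i2 : Integrable (fun a => wave s (Prod.fst a).1 * wave t (Prod.snd a).2) (μ.prod μ) :=
    hs.mul_prod ht
  have i3 : Integrable (fun a => wave t (Prod.fst a).2 * wave s (Prod.snd a).1) (μ.prod μ) :=
    ht.mul_prod hs
  have e : ∀ a : (V × W) × (V × W), waveDiff s (pairFst a) * waveDiff t (pairSnd a) =
      wave s a.1.1 * wave t a.1.2 - wave s a.1.1 * wave t a.2.2 - wave t a.1.2 * wave s a.2.1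
        + wave s a.2.1 * wave t a.2.2 := by
    intro a; simp only [waveDiff, pairFst, pairSnd]; ring
  simp_rw [e]
  rw [integral_add ((Integrable.sub' i1 i2).sub' i3) i4, integral_sub (i1.sub' i2) i3,
    integral_sub i1 i2]
  have f1 : ∫ a, wave s (Prod.fst a).1 * wave t (Prod.fst a).2 ∂(μ.prod μ) = lawCharFun μ s t := by
    simpa [lawCharFun] using integral_fun_fst (μ := μ) (ν := μ) (fun z => wave s z.1 * wave t z.2)
  have f4 : ∫ a, wave s (Prod.snd a).1 * wave t (Prod.snd a).2 ∂(μ.prod μ) = lawCharFun μ s t := by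
    simpa [lawCharFun] using integral_fun_snd (μ := μ) (ν := μ) (fun z => wave s z.1 * wave t z.2)
  have f2 := integral_prod_mul (μ := μ) (ν := μ) (fun z => wave s z.1) (fun z => wave t z.2)
  have f3 := integral_prod_mul (μ := μ) (ν := μ) (fun z => wave t z.2) (fun z => wave s z.1)
  rw [f1, f4, f2, f3]
  simp only [lawCharFun, wave_zero_left, mul_one, one_mul]
  ring

lemma lintegral_norm_sub_fst_lt_top (hX : Integrable (fun z => z.1) μ) (C : ℝ) :
    ∫⁻ a, ENNReal.ofReal (C * (2 * ‖(pairFst a).1 - (pairFst a).2‖)) ∂(μ.prod μ) < ∞ := by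
  have : Integrable (fun a => C * (2 * ‖(pairFst a).1 - (pairFst a).2‖)) (μ.prod μ) :=
    ((((hX.comp_fst μ).sub (hX.comp_snd μ)).norm).const_mul 2).const_mul C
  exact this.lintegral_lt_top

lemma lintegral_norm_sub_snd_lt_top (hY : Integrable (fun z => z.2) μ) (C : ℝ) :
    ∫⁻ a, ENNReal.ofReal (C * (2 * ‖(pairSnd a).1 - (pairSnd a).2‖)) ∂(μ.prod μ) < ∞ := by
  have : Integrable (fun a => C * (2 * ‖(pairSnd a).1 - (pairSnd a).2‖)) (μ.prod μ) :=
    ((((hY.comp_fst μ).sub (hY.comp_snd μ)).norm).const_mul 2).const_mul C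
  exact this.lintegral_lt_top

/-- A measure on an inner product space that turns squared wave differences into distances. -/
structure IsDistWeight (w : Measure V) (c : ℝ) : Prop where
  lintegral_norm_sq : ∀ u : V × V, ∫⁻ s, ENNReal.ofReal (‖waveDiff s u‖ ^ 2) ∂w =
    ENNReal.ofReal (c * (2 * ‖u.1 - u.2‖))
  integral_mul_conj : ∀ u v : V × V, ∫ s, waveDiff s u * conj (waveDiff s v) ∂w =
    ((-(c * distDiff u v) : ℝ) : ℂ)

variable {wV : Measure V} {wW : Measure W} [SFinite wV] [SFinite wW] {c d : ℝ}

/-- Integrating the wave product over the frequencies recovers the two distances. -/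
lemma integral_waveProd_left (hV : IsDistWeight wV c) (hW : IsDistWeight wW d)
    (ab : ((V × W) × (V × W)) × ((V × W) × (V × W))) :
    ∫ st, waveProd (st, ab) ∂(wV.prod wW) =
      ((c * d * (distDiff (pairFst ab.1) (pairFst ab.2) *
        distDiff (pairSnd ab.1) (pairSnd ab.2)) : ℝ) : ℂ) := by
  have := integral_prod_mul (μ := wV) (ν := wW)
    (fun s => waveDiff s (pairFst ab.1) * conj (waveDiff s (pairFst ab.2)))
    (fun t => waveDiff t (pairSnd ab.1) * conj (waveDiff t (pairSnd ab.2)))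
  rw [hV.integral_mul_conj, hW.integral_mul_conj] at this
  refine this.trans ?_
  push_cast; ring

/-- This justifies every later use of Fubini. By Tonelli, integrating the crossed bound over the
frequencies leaves products of finite means of `‖X - X'‖` and `‖Y - Y'‖`. -/
lemma integrable_waveProd (hV : IsDistWeight wV c) (hW : IsDistWeight wW d)
    (hX : Integrable (fun z => z.1) μ) (hY : Integrable (fun z => z.2) μ) :
    Integrable waveProd ((wV.prod wW).prod ((μ.prod μ).prod (μ.prod μ))) := by
  refine ⟨measurable_waveProd.aestronglyMeasurable, ?_⟩
  unfold HasFiniteIntegral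
  rw [lintegral_prod_symm _ measurable_waveProd.enorm.aemeasurable]
  have m1 : ∀ u, Measurable fun s : V => ENNReal.ofReal (‖waveDiff s u‖ ^ 2) :=
    fun u => by fun_prop
  have m2 : ∀ u, Measurable fun t : W => ENNReal.ofReal (‖waveDiff t u‖ ^ 2) :=
    fun u => by fun_prop
  have e : ∀ a b : (V × W) × (V × W),
      ∫⁻ st, ENNReal.ofReal (‖waveDiff (Prod.fst st) (pairFst a)‖ ^ 2) *
        ENNReal.ofReal (‖waveDiff (Prod.snd st) (pairSnd b)‖ ^ 2) ∂(wV.prod wW) =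
      ENNReal.ofReal (c * (2 * ‖(pairFst a).1 - (pairFst a).2‖)) *
        ENNReal.ofReal (d * (2 * ‖(pairSnd b).1 - (pairSnd b).2‖)) := by
    intro a b
    rw [← hV.lintegral_norm_sq, ← hW.lintegral_norm_sq]
    exact lintegral_prod_mul (m1 _).aemeasurable (m2 _).aemeasurable
  have key : ∀ ab : ((V × W) × (V × W)) × ((V × W) × (V × W)),
      ∫⁻ st, ‖waveProd (st, ab)‖ₑ ∂(wV.prod wW) ≤
      ENNReal.ofReal (c * (2 * ‖(pairFst ab.1).1 - (pairFst ab.1).2‖)) *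
        ENNReal.ofReal (d * (2 * ‖(pairSnd ab.2).1 - (pairSnd ab.2).2‖)) +
      ENNReal.ofReal (d * (2 * ‖(pairSnd ab.1).1 - (pairSnd ab.1).2‖)) *
        ENNReal.ofReal (c * (2 * ‖(pairFst ab.2).1 - (pairFst ab.2).2‖)) := by
    rintro ⟨a, b⟩
    have h := lintegral_mono (μ := wV.prod wW) (fun st => enorm_waveProd_le st a b)
    have m : Measurable fun st : V × W => ENNReal.ofReal (‖waveDiff st.1 (pairFst a)‖ ^ 2) *
        ENNReal.ofReal (‖waveDiff st.2 (pairSnd b)‖ ^ 2) := by fun_prop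
    rw [lintegral_add_left m, e, e] at h
    rw [mul_comm (ENNReal.ofReal (d * (2 * ‖(pairSnd a).1 - (pairSnd a).2‖)))]
    exact h
  have mX : Measurable fun a : (V × W) × (V × W) =>
      ENNReal.ofReal (c * (2 * ‖(pairFst a).1 - (pairFst a).2‖)) := by fun_prop
  have mY : Measurable fun a : (V × W) × (V × W) =>
      ENNReal.ofReal (d * (2 * ‖(pairSnd a).1 - (pairSnd a).2‖)) := by fun_prop
  have m : Measurable fun ab : ((V × W) × (V × W)) × ((V × W) × (V × W)) =>
      ENNReal.ofReal (c * (2 * ‖(pairFst ab.1).1 - (pairFst ab.1).2‖)) *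
        ENNReal.ofReal (d * (2 * ‖(pairSnd ab.2).1 - (pairSnd ab.2).2‖)) := by fun_prop
  refine (lintegral_mono key).trans_lt ?_
  rw [lintegral_add_left m,
    lintegral_prod_mul mX.aemeasurable mY.aemeasurable,
    lintegral_prod_mul mY.aemeasurable mX.aemeasurable]
  have h1 := lintegral_norm_sub_fst_lt_top μ hX c
  have h2 := lintegral_norm_sub_snd_lt_top μ hY d
  exact ENNReal.add_lt_top.2 ⟨ENNReal.mul_lt_top h1 h2, ENNReal.mul_lt_top h2 h1⟩

/-- At fixed frequencies the integrand is a function of one pair times the conjugate of the same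
function of an independent pair, so its mean is a squared modulus. The 4 is the square of the 2 in
`integral_waveDiff_mul_waveDiff`. -/
lemma integral_waveProd_right (st : V × W) :
    ∫ ab, waveProd (st, ab) ∂((μ.prod μ).prod (μ.prod μ)) =
      ((4 * ‖lawCharFun μ st.1 st.2 - lawCharFun μ st.1 0 * lawCharFun μ 0 st.2‖ ^ 2 : ℝ) : ℂ) := by
  have := integral_prod_mul (μ := μ.prod μ) (ν := μ.prod μ)
    (fun a => waveDiff st.1 (pairFst a) * waveDiff st.2 (pairSnd a))
    (fun a => conj (waveDiff st.1 (pairFst a) * waveDiff st.2 (pairSnd a)))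
  rw [integral_conj, integral_waveDiff_mul_waveDiff, Complex.mul_conj,
    Complex.normSq_eq_norm_sq, norm_mul, mul_pow] at this
  convert! this using 1
  · congr 1 with ab
    simp only [waveProd, map_mul]; ring
  · norm_num

/-- The expectation of the product of the mixed second differences of the two distances. -/
noncomputable def distDiffMean : ℝ :=
  ∫ ab, distDiff (pairFst ab.1) (pairFst ab.2) * distDiff (pairSnd ab.1) (pairSnd ab.2)
    ∂((μ.prod μ).prod (μ.prod μ))

/-- This is a by-product of Fubini: the partial integral of an integrable function is integrable, so
only first moments enter. -/
lemma integrable_distDiff_mul (hV : IsDistWeight wV c) (hW : IsDistWeight wW d)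
    (hc : c ≠ 0) (hd : d ≠ 0) (hX : Integrable (fun z => z.1) μ)
    (hY : Integrable (fun z => z.2) μ) :
    Integrable (fun ab => distDiff (pairFst ab.1) (pairFst ab.2) *
      distDiff (pairSnd ab.1) (pairSnd ab.2)) ((μ.prod μ).prod (μ.prod μ)) := by
  have h := (integrable_waveProd μ hV hW hX hY).integral_prod_right
  simp only [integral_waveProd_left hV hW] at h
  have h' := (h.re).const_mul (c * d)⁻¹
  refine h'.congr (ae_of_all _ fun ab => ?_)
  simp only [RCLike.re_eq_complex_re, Complex.ofReal_re]
  field_simp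

lemma integral_lawCharFun (hV : IsDistWeight wV c) (hW : IsDistWeight wW d)
    (hX : Integrable (fun z => z.1) μ) (hY : Integrable (fun z => z.2) μ) :
    ∫ st, (4 * ‖lawCharFun μ st.1 st.2 - lawCharFun μ st.1 0 * lawCharFun μ 0 st.2‖ ^ 2)
      ∂(wV.prod wW) = c * d * distDiffMean μ := by
  have hs := integral_integral_swap (f := fun st ab => waveProd (st, ab))
    (integrable_waveProd μ hV hW hX hY)
  simp only [integral_waveProd_right, integral_waveProd_left hV hW] at hs
  rw [integral_complex_ofReal, integral_complex_ofReal, integral_const_mul (c * d)] at hs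
  exact_mod_cast hs

lemma distDiffMean_nonneg (hV : IsDistWeight wV c) (hW : IsDistWeight wW d) (hc : 0 < c)
    (hd : 0 < d) (hX : Integrable (fun z => z.1) μ) (hY : Integrable (fun z => z.2) μ) :
    0 ≤ distDiffMean μ := by
  refine nonneg_of_mul_nonneg_right ?_ (mul_pos hc hd)
  rw [← integral_lawCharFun μ hV hW hX hY]
  exact integral_nonneg fun st => by positivity

lemma lintegral_lawCharFun (hV : IsDistWeight wV c) (hW : IsDistWeight wW d)
    (hX : Integrable (fun z => z.1) μ) (hY : Integrable (fun z => z.2) μ) :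
    ∫⁻ st, ENNReal.ofReal
      (‖lawCharFun μ st.1 st.2 - lawCharFun μ st.1 0 * lawCharFun μ 0 st.2‖ ^ 2)
      ∂(wV.prod wW) =
    ENNReal.ofReal (c * d * (distDiffMean μ / 4)) := by
  have hi := integrable_waveProd μ hV hW hX hY
  have h := hi.integral_prod_left.re
  simp only [integral_waveProd_right, RCLike.re_eq_complex_re, Complex.ofReal_re] at h
  have h4 := h.const_mul (1 / 4)
  have e := integral_lawCharFun μ hV hW hX hY
  have e' : ∀ x : ℝ, 1 / 4 * (4 * x) = x := fun x => by ring
  simp only [e'] at h4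
  rw [← ofReal_integral_eq_lintegral_ofReal h4 (ae_of_all _ fun _ => by positivity)]
  rw [integral_const_mul] at e
  congr 1; linarith

lemma measurable_norm_lawCharFun_sub_sq : Measurable fun st : V × W => ENNReal.ofReal
    (‖lawCharFun μ st.1 st.2 - lawCharFun μ st.1 0 * lawCharFun μ 0 st.2‖ ^ 2) := by
  fun_prop

lemma lintegral_lintegral_lawCharFun (hV : IsDistWeight wV c) (hW : IsDistWeight wW d)
    (hX : Integrable (fun z => z.1) μ) (hY : Integrable (fun z => z.2) μ) :
    ∫⁻ s, ∫⁻ t, ENNReal.ofReal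
      (‖lawCharFun μ s t - lawCharFun μ s 0 * lawCharFun μ 0 t‖ ^ 2) ∂wW ∂wV =
    ENNReal.ofReal (c * d * (distDiffMean μ / 4)) := by
  rw [← lintegral_lawCharFun μ hV hW hX hY,
    lintegral_prod _ (measurable_norm_lawCharFun_sub_sq μ).aemeasurable]

end Law

section DcovSq
variable {p q : ℕ}

lemma isDistWeight_weight (p : ℕ) : IsDistWeight (weight p) (normConst p) where
  lintegral_norm_sq u := by rw [lintegral_norm_waveDiff_sq]; congr 1; ring
  integral_mul_conj := integral_waveDiff_mul_conj

variable {Ω : Type*} [MeasurableSpace Ω] (P : Measure Ω) [IsProbabilityMeasure P]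
  (X : Ω → EuclideanSpace ℝ (Fin p)) (Y : Ω → EuclideanSpace ℝ (Fin q))

lemma jointCharFun_eq_lawCharFun (hX : Measurable X) (hY : Measurable Y)
    (s : EuclideanSpace ℝ (Fin p)) (t : EuclideanSpace ℝ (Fin q)) :
    jointCharFun P X Y s t = lawCharFun (P.map fun ω => (X ω, Y ω)) s t := by
  have : IsProbabilityMeasure (P.map fun ω => (X ω, Y ω)) :=
    Measure.isProbabilityMeasure_map (by fun_prop)
  rw [lawCharFun, integral_map (by fun_prop)
    (integrable_wave_mul_wave _ s t).aestronglyMeasurable]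
  simp only [jointCharFun, wave, Complex.exp_add]

theorem dcovSq_eq (hX : Measurable X) (hY : Measurable Y)
    (hX1 : Integrable X P) (hY1 : Integrable Y P) :
    dcovSq P X Y = ENNReal.ofReal (distDiffMean (P.map fun ω => (X ω, Y ω)) / 4) := by
  set μ := P.map fun ω => (X ω, Y ω) with hμ
  have hXY : AEMeasurable (fun ω => (X ω, Y ω)) P := by fun_prop
  have : IsProbabilityMeasure μ := Measure.isProbabilityMeasure_map hXY
  have i1 : Integrable (fun z => z.1) μ :=
    (integrable_map_measure (by fun_prop) hXY).2 hX1
  have i2 : Integrable (fun z => z.2) μ :=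
    (integrable_map_measure (by fun_prop) hXY).2 hY1
  have h := lintegral_lintegral_lawCharFun μ (isDistWeight_weight p) (isDistWeight_weight q) i1 i2
  rw [lintegral_weight _ (measurable_norm_lawCharFun_sub_sq μ).lintegral_prod_right'] at h
  have hc := mul_pos (normConst_pos p) (normConst_pos q)
  rw [dcovSq, show distDiffMean μ / 4 = 1 / (normConst p * normConst q) *
    (normConst p * normConst q * (distDiffMean μ / 4)) by
      rw [← mul_assoc, one_div, inv_mul_cancel₀ hc.ne', one_mul],
    ENNReal.ofReal_mul (by positivity), ← h]
  congr 1
  refine lintegral_congr fun s => ?_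
  rw [lintegral_weight _ (by fun_prop), ← lintegral_const_mul' _ _ (by finiteness)]
  refine lintegral_congr fun t => ?_
  rw [← ENNReal.ofReal_mul (by positivity), ← ENNReal.ofReal_mul (by positivity)]
  simp only [jointCharFun_eq_lawCharFun P X Y hX hY]
  congr 1
  rw [one_div, one_div, div_eq_mul_inv, mul_inv]
  ring

end DcovSq

end DistCov

/-! ### The kernel and its mean. -/

namespace DistCov

section Kernel
variable {p q : ℕ}

lemma kernel_comp_perm (z : Fin 4 → EuclideanSpace ℝ (Fin p) × EuclideanSpace ℝ (Fin q))
    (τ : Equiv.Perm (Fin 4)) : kernel (fun i => z (τ i)) = kernel z := by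
  unfold kernel
  congr 1
  exact Equiv.sum_comp (Equiv.mulLeft τ) fun σ : Equiv.Perm (Fin 4) =>
    (‖(z (σ 0)).1 - (z (σ 1)).1‖ * ‖(z (σ 0)).2 - (z (σ 1)).2‖
      - 2 * (‖(z (σ 0)).1 - (z (σ 1)).1‖ * ‖(z (σ 0)).2 - (z (σ 2)).2‖)
      + ‖(z (σ 0)).1 - (z (σ 1)).1‖ * ‖(z (σ 2)).2 - (z (σ 3)).2‖)

/-- A sum over permutations of four indices may be reindexed by any fixed permutation. -/
lemma sum_perm_four_reindex (F : Fin 4 → Fin 4 → Fin 4 → Fin 4 → ℝ) (τ : Equiv.Perm (Fin 4)) :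
    ∑ σ : Equiv.Perm (Fin 4), F (σ (τ 0)) (σ (τ 1)) (σ (τ 2)) (σ (τ 3)) =
      ∑ σ : Equiv.Perm (Fin 4), F (σ 0) (σ 1) (σ 2) (σ 3) :=
  Equiv.sum_comp (Equiv.mulRight τ) fun σ : Equiv.Perm (Fin 4) => F (σ 0) (σ 1) (σ 2) (σ 3)

/-- The pairs 01, 02, 31, 32 are the edges of a 4-cycle. Among the 16 products, 4 match an edge with
itself, 8 match adjacent edges with sign `-`, and 4 match opposite edges with sign `+`. Summing over
permutations identifies the products within each class. -/
lemma sum_perm_four_mixed_diff (d e : Fin 4 → Fin 4 → ℝ) (hd : ∀ i j, d i j = d j i)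
    (he : ∀ i j, e i j = e j i) :
    ∑ σ : Equiv.Perm (Fin 4), (d (σ 0) (σ 1) - d (σ 0) (σ 2) - d (σ 3) (σ 1) + d (σ 3) (σ 2)) *
      (e (σ 0) (σ 1) - e (σ 0) (σ 2) - e (σ 3) (σ 1) + e (σ 3) (σ 2)) =
    4 * ∑ σ : Equiv.Perm (Fin 4), (d (σ 0) (σ 1) * e (σ 0) (σ 1)
      - 2 * (d (σ 0) (σ 1) * e (σ 0) (σ 2)) + d (σ 0) (σ 1) * e (σ 2) (σ 3)) := by
  -- The reindexings `h1`, `h2`, `h3` move every `d` factor to the edge 01; `h4` then identifies the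
  -- two kinds of adjacent edge.
  have h1 := sum_perm_four_reindex (fun i j k l =>
    d i j * (e i j - e i k - e l j + e l k)) (Equiv.swap 1 2)
  have h2 := sum_perm_four_reindex (fun i j k l =>
    d i j * (e i j - e i k - e l j + e l k)) (Equiv.swap 0 3)
  have h3 := sum_perm_four_reindex (fun i j k l =>
    d i j * (e i j - e i k - e l j + e l k)) (Equiv.swap 0 3 * Equiv.swap 1 2)
  have h4 := sum_perm_four_reindex (fun i j k l => d i j * e i k)
    (Equiv.swap 0 1 * Equiv.swap 2 3)
  have s1 : (Equiv.swap 1 2 : Equiv.Perm (Fin 4)) 0 = 0 ∧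
    (Equiv.swap 1 2 : Equiv.Perm (Fin 4)) 1 = 2 ∧ (Equiv.swap 1 2 : Equiv.Perm (Fin 4)) 2 = 1 ∧
    (Equiv.swap 1 2 : Equiv.Perm (Fin 4)) 3 = 3 := by decide
  have s2 : (Equiv.swap 0 3 : Equiv.Perm (Fin 4)) 0 = 3 ∧
    (Equiv.swap 0 3 : Equiv.Perm (Fin 4)) 1 = 1 ∧ (Equiv.swap 0 3 : Equiv.Perm (Fin 4)) 2 = 2 ∧
    (Equiv.swap 0 3 : Equiv.Perm (Fin 4)) 3 = 0 := by decide
  have s3 : (Equiv.swap 0 1 : Equiv.Perm (Fin 4)) 0 = 1 ∧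
    (Equiv.swap 0 1 : Equiv.Perm (Fin 4)) 1 = 0 ∧ (Equiv.swap 0 1 : Equiv.Perm (Fin 4)) 2 = 2 ∧
    (Equiv.swap 0 1 : Equiv.Perm (Fin 4)) 3 = 3 := by decide
  have s4 : (Equiv.swap 2 3 : Equiv.Perm (Fin 4)) 0 = 0 ∧
    (Equiv.swap 2 3 : Equiv.Perm (Fin 4)) 1 = 1 ∧ (Equiv.swap 2 3 : Equiv.Perm (Fin 4)) 2 = 3 ∧
    (Equiv.swap 2 3 : Equiv.Perm (Fin 4)) 3 = 2 := by decide
  simp only [Equiv.Perm.mul_apply, s1, s2, s3, s4] at h1 h2 h3 h4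
  simp only [add_mul, sub_mul, mul_add, mul_sub, Finset.sum_add_distrib, Finset.sum_sub_distrib,
    ← Finset.mul_sum] at h1 h2 h3 h4 ⊢
  have c1 : ∀ σ : Equiv.Perm (Fin 4), d (σ 1) (σ 0) = d (σ 0) (σ 1) := fun σ => hd _ _
  have c2 : ∀ σ : Equiv.Perm (Fin 4), e (σ 1) (σ 3) = e (σ 3) (σ 1) := fun σ => he _ _
  have c3 : ∀ σ : Equiv.Perm (Fin 4), e (σ 2) (σ 3) = e (σ 3) (σ 2) := fun σ => he _ _
  simp only [c1, c2, c3] at h1 h2 h3 h4 ⊢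
  linarith

lemma kernel_eq_sum_distDiff
    (z : Fin 4 → EuclideanSpace ℝ (Fin p) × EuclideanSpace ℝ (Fin q)) :
    kernel z = 1 / 96 * ∑ σ : Equiv.Perm (Fin 4),
      distDiff (pairFst (z (σ 0), z (σ 3))) (pairFst (z (σ 1), z (σ 2))) *
      distDiff (pairSnd (z (σ 0), z (σ 3))) (pairSnd (z (σ 1), z (σ 2))) := by
  have h := sum_perm_four_mixed_diff (fun i j => ‖(z i).1 - (z j).1‖)
    (fun i j => ‖(z i).2 - (z j).2‖) (fun i j => norm_sub_rev _ _) (fun i j => norm_sub_rev _ _)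
  simp only [distDiff, pairFst, pairSnd]
  rw [h, kernel]
  ring

lemma measurable_kernel : Measurable (kernel (p := p) (q := q)) := by
  unfold kernel
  fun_prop

end Kernel

lemma map_pi_pair {S ι : Type*} [MeasurableSpace S] [Fintype ι] (μ : Measure S)
    [IsProbabilityMeasure μ] {i j : ι} (hij : i ≠ j) :
    (Measure.pi fun _ : ι => μ).map (fun z => (z i, z j)) = μ.prod μ := by
  have h : iIndepFun (fun (i : ι) (z : ι → S) => z i) (Measure.pi fun _ => μ) :=
    iIndepFun_pi (X := fun _ x => x) fun _ => aemeasurable_id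
  rw [(h.indepFun hij).map_prod_eq_prod_map_map (measurable_pi_apply i).aemeasurable
    (measurable_pi_apply j).aemeasurable,
    (measurePreserving_eval _ i).map_eq, (measurePreserving_eval _ j).map_eq]

lemma map_pi_pair_pair {S ι : Type*} [MeasurableSpace S] [Fintype ι] (μ : Measure S)
    [IsProbabilityMeasure μ] {i j k l : ι} (hij : i ≠ j) (hkl : k ≠ l) (hik : i ≠ k) (hil : i ≠ l)
    (hjk : j ≠ k) (hjl : j ≠ l) :
    (Measure.pi fun _ : ι => μ).map (fun z => ((z i, z j), (z k, z l))) =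
      (μ.prod μ).prod (μ.prod μ) := by
  have h : iIndepFun (fun (i : ι) (z : ι → S) => z i) (Measure.pi fun _ => μ) :=
    iIndepFun_pi (X := fun _ x => x) fun _ => aemeasurable_id
  rw [(h.indepFun_prodMk_prodMk (by fun_prop) i j k l hik hil hjk hjl).map_prod_eq_prod_map_map
    (by fun_prop) (by fun_prop), map_pi_pair μ hij, map_pi_pair μ hkl]

lemma integral_kernel {p q : ℕ}
    (μ : Measure (EuclideanSpace ℝ (Fin p) × EuclideanSpace ℝ (Fin q))) [IsProbabilityMeasure μ]
    (hX : Integrable (fun z => z.1) μ) (hY : Integrable (fun z => z.2) μ) :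
    ∫ z, kernel z ∂(Measure.pi fun _ : Fin 4 => μ) = distDiffMean μ / 4 := by
  have hi := integrable_distDiff_mul μ (isDistWeight_weight p) (isDistWeight_weight q)
    (normConst_pos p).ne' (normConst_pos q).ne' hX hY
  have hmap := fun σ : Equiv.Perm (Fin 4) => map_pi_pair_pair μ (i := σ 0) (j := σ 3) (k := σ 1)
    (l := σ 2) (by simp) (by simp) (by simp) (by simp) (by simp) (by simp)
  have hm : ∀ σ : Equiv.Perm (Fin 4), AEMeasurable
      (fun z : Fin 4 → EuclideanSpace ℝ (Fin p) × EuclideanSpace ℝ (Fin q) =>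
        ((z (σ 0), z (σ 3)), (z (σ 1), z (σ 2)))) (Measure.pi fun _ : Fin 4 => μ) :=
    fun σ => by fun_prop
  simp_rw [kernel_eq_sum_distDiff]
  rw [integral_const_mul, integral_finsetSum]
  · have : ∀ σ : Equiv.Perm (Fin 4), ∫ z,
        distDiff (pairFst (z (σ 0), z (σ 3))) (pairFst (z (σ 1), z (σ 2))) *
        distDiff (pairSnd (z (σ 0), z (σ 3))) (pairSnd (z (σ 1), z (σ 2)))
        ∂(Measure.pi fun _ : Fin 4 => μ) = distDiffMean μ := by
      intro σ
      rw [distDiffMean, ← hmap σ, integral_map (hm σ)]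
      rw [hmap σ]
      exact hi.aestronglyMeasurable
    -- All 24 permutations contribute equally, and `24/96 = 1/4`.
    simp only [this, Finset.sum_const, Finset.card_univ, Fintype.card_perm, Fintype.card_fin]
    simp [Nat.factorial]
    ring
  · intro σ _
    rw [← hmap σ] at hi
    exact hi.comp_aemeasurable (hm σ)

theorem dcovSq_eq_integral_kernel {p q : ℕ} {Ω : Type*} [MeasurableSpace Ω] (P : Measure Ω)
    [IsProbabilityMeasure P] (X : Ω → EuclideanSpace ℝ (Fin p)) (Y : Ω → EuclideanSpace ℝ (Fin q))
    (hX : Measurable X) (hY : Measurable Y) (hX1 : Integrable X P) (hY1 : Integrable Y P) :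
    dcovSq P X Y < ∞ ∧ (dcovSq P X Y).toReal =
      ∫ z, kernel z ∂(Measure.pi fun _ : Fin 4 => P.map fun ω => (X ω, Y ω)) := by
  set μ := P.map fun ω => (X ω, Y ω) with hμ
  have hXY : AEMeasurable (fun ω => (X ω, Y ω)) P := by fun_prop
  have : IsProbabilityMeasure μ := Measure.isProbabilityMeasure_map hXY
  have i1 : Integrable (fun z => z.1) μ :=
    (integrable_map_measure (by fun_prop) hXY).2 hX1
  have i2 : Integrable (fun z => z.2) μ :=
    (integrable_map_measure (by fun_prop) hXY).2 hY1
  rw [dcovSq_eq P X Y hX hY hX1 hY1, integral_kernel μ i1 i2]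
  refine ⟨by finiteness, ENNReal.toReal_ofReal ?_⟩
  have := distDiffMean_nonneg μ (isDistWeight_weight p) (isDistWeight_weight q)
    (normConst_pos p) (normConst_pos q) i1 i2
  positivity

end DistCov

/-! ### Hoeffding projections and uncorrelated terms. -/

namespace UStatistic

section Hoeffding
variable {S : Type*} [MeasurableSpace S] {m : ℕ} (μ : Measure S)
  (h : (Fin (m + 1) → S) → ℝ)

/-- The mean of a kernel under independent arguments with law `μ`. -/
noncomputable def mean : ℝ := ∫ z, h z ∂(Measure.pi fun _ => μ)

/-- The first projection of a kernel: all arguments but the first are integrated out. -/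
noncomputable def proj (x : S) : ℝ :=
  ∫ w : Fin m → S, h (Fin.cons x w : Fin (m + 1) → S) ∂(Measure.pi fun _ => μ)

/-- The kernel minus its mean and its centred first projections. -/
noncomputable def residual (z : Fin (m + 1) → S) : ℝ :=
  h z - mean μ h - ∑ a, (proj μ h (z a) - mean μ h)

lemma measurable_insertNth (b : Fin (m + 1)) :
    Measurable fun r : S × (Fin m → S) => (b.insertNth r.1 r.2 : Fin (m + 1) → S) :=
  (MeasurableEquiv.piFinSuccAbove (fun _ => S) b).symm.measurable

variable [IsProbabilityMeasure μ]

lemma measurePreserving_insertNth (b : Fin (m + 1)) :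
    MeasurePreserving (fun r : S × (Fin m → S) => (b.insertNth r.1 r.2 : Fin (m + 1) → S))
      (μ.prod (Measure.pi fun _ => μ)) (Measure.pi fun _ => μ) :=
  (measurePreserving_piFinSuccAbove (fun _ : Fin (m + 1) => μ) b).symm

variable {μ h}

lemma integrable_insertNth (hi : Integrable h (Measure.pi fun _ => μ)) (b : Fin (m + 1)) :
    Integrable (fun r : S × (Fin m → S) => h (b.insertNth r.1 r.2))
      (μ.prod (Measure.pi fun _ => μ)) :=
  (measurePreserving_insertNth μ b).integrable_comp_of_integrable hi

lemma proj_eq (x : S) :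
    proj μ h x = ∫ w, h ((0 : Fin (m + 1)).insertNth x w) ∂(Measure.pi fun _ : Fin m => μ) := by
  simp only [proj, Fin.insertNth_zero']

/-- Insertion at `b` and insertion at 0 differ by a cyclic permutation of the arguments, which a
symmetric kernel does not see. -/
lemma integral_insertNth (hsymm : ∀ z (σ : Equiv.Perm (Fin (m + 1))), h (fun i => z (σ i)) = h z)
    (b : Fin (m + 1)) (x : S) :
    ∫ w, h (b.insertNth x w) ∂(Measure.pi fun _ : Fin m => μ) = proj μ h x := by
  unfold proj
  congr 1 with w
  rw [← Fin.cons_comp_cycleRange]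
  exact hsymm _ _

lemma integrable_proj (hi : Integrable h (Measure.pi fun _ => μ)) : Integrable (proj μ h) μ := by
  have := (integrable_insertNth hi 0).integral_prod_left
  simpa only [← proj_eq] using this

lemma integral_proj (hi : Integrable h (Measure.pi fun _ => μ)) :
    ∫ x, proj μ h x ∂μ = mean μ h := by
  have hmp := measurePreserving_insertNth μ (m := m) 0
  simp_rw [proj_eq]
  rw [← integral_prod _ (integrable_insertNth hi 0), mean, ← hmp.map_eq,
    integral_map hmp.aemeasurable (by rw [hmp.map_eq]; exact hi.aestronglyMeasurable)]

lemma measurable_proj (hm : Measurable h) : Measurable (proj μ h) := by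
  have : Measurable fun r : S × (Fin m → S) => h ((0 : Fin (m + 1)).insertNth r.1 r.2) :=
    hm.comp (measurable_insertNth 0)
  have h2 := this.stronglyMeasurable.integral_prod_right' (ν := Measure.pi fun _ : Fin m => μ)
  simpa only [← proj_eq] using h2.measurable

lemma measurable_residual (hm : Measurable h) : Measurable (residual μ h) := by
  have := measurable_proj (μ := μ) hm
  unfold residual
  fun_prop

lemma memLp_residual (hL : MemLp h 2 (Measure.pi fun _ => μ)) (hp : MemLp (proj μ h) 2 μ) :
    MemLp (residual μ h) 2 (Measure.pi fun _ => μ) := by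
  refine (hL.sub (memLp_const _)).sub (memLp_finsetSum _ fun a _ => ?_)
  exact (hp.comp_measurePreserving (measurePreserving_eval (fun _ => μ) a)).sub (memLp_const _)

/-- Given the argument at `b`, the kernel averages to its projection there. The subtracted mean and
the projection term at `b` remove exactly this, and the other projection terms are centred. -/
lemma integral_residual_insertNth
    (hsymm : ∀ z (σ : Equiv.Perm (Fin (m + 1))), h (fun i => z (σ i)) = h z)
    (hi : Integrable h (Measure.pi fun _ => μ)) (b : Fin (m + 1)) :
    ∀ᵐ x ∂μ, ∫ w, residual μ h (b.insertNth x w) ∂(Measure.pi fun _ : Fin m => μ) = 0 := by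
  filter_upwards [(integrable_insertNth hi b).prod_right_ae] with x hx
  have hp := integrable_proj hi
  have hpa : ∀ j : Fin m, Integrable (fun w : Fin m → S => proj μ h (w j) - mean μ h)
      (Measure.pi fun _ => μ) := fun j =>
    ((measurePreserving_eval (fun _ => μ) j).integrable_comp_of_integrable hp).sub
      (integrable_const _)
  have e : ∀ w : Fin m → S, residual μ h (b.insertNth x w) =
      h (b.insertNth x w) - proj μ h x - ∑ j, (proj μ h (w j) - mean μ h) := by
    intro w
    simp only [residual, Fin.sum_univ_succAbove _ b, Fin.insertNth_apply_same,
      Fin.insertNth_apply_succAbove]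
    ring
  have z : ∀ j : Fin m, ∫ w : Fin m → S, (proj μ h (w j) - mean μ h)
      ∂(Measure.pi fun _ => μ) = 0 := by
    intro j
    have hmp := measurePreserving_eval (fun _ : Fin m => μ) j
    have := integral_map hmp.aemeasurable (f := fun x => proj μ h x - mean μ h)
      (by rw [hmp.map_eq]; exact (hp.sub (integrable_const _)).aestronglyMeasurable)
    rw [hmp.map_eq, integral_sub hp (integrable_const _), integral_proj hi] at this
    rw [show (∫ w : Fin m → S, (proj μ h (w j) - mean μ h) ∂(Measure.pi fun _ => μ)) = _
      from this.symm]
    simp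
  simp_rw [e]
  rw [integral_sub (Integrable.sub' hx (integrable_const _))
    (integrable_finsetSum _ fun j _ => hpa j), integral_sub hx (integrable_const _),
    integral_insertNth hsymm, integral_finsetSum _ fun j _ => hpa j]
  simp [z]

end Hoeffding

section Sample
variable {S : Type*} [MeasurableSpace S] {m : ℕ} {μ : Measure S} [IsProbabilityMeasure μ]
  {Ω : Type*} [MeasurableSpace Ω] {P : Measure Ω} [IsProbabilityMeasure P] {Z : ℕ → Ω → S}

lemma map_sample (hindep : iIndepFun Z P) (hZ : ∀ i, AEMeasurable (Z i) P)
    (hlaw : ∀ i, P.map (Z i) = μ) {κ : Type*} [Fintype κ] {τ : κ → ℕ}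
    (hτ : Function.Injective τ) :
    P.map (fun ω a => Z (τ a) ω) = Measure.pi fun _ : κ => μ := by
  have := (hindep.precomp hτ).map_fun_eq_pi_map (fun a => hZ (τ a))
  simpa only [hlaw] using this

/-- A kernel with vanishing conditional expectations is uncorrelated over two index tuples that
share at most one index. -/
lemma integral_mul_eq_zero (hindep : iIndepFun Z P) (hZ : ∀ i, AEMeasurable (Z i) P)
    (hlaw : ∀ i, P.map (Z i) = μ) {g : (Fin (m + 1) → S) → ℝ} (hg : Measurable g)
    {b : Fin (m + 1)}
    (hdeg : ∀ᵐ x ∂μ, ∫ w, g (b.insertNth x w) ∂(Measure.pi fun _ : Fin m => μ) = 0)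
    {τ τ' : Fin (m + 1) → ℕ} (hτ' : Function.Injective τ')
    (hb : ∀ a, a ≠ b → τ' a ∉ Set.range τ) :
    ∫ ω, g (fun a => Z (τ a) ω) * g (fun a => Z (τ' a) ω) ∂P = 0 := by
  classical
  -- `U` carries the whole first tuple and the one index that may be shared; `W` carries the
  -- remaining indices of the second tuple, which occur nowhere in `U`. Hence they are independent,
  -- and integrating over `W` first gives zero.
  set U : Ω → (Fin (m + 1) → S) × S := fun ω => (fun a => Z (τ a) ω, Z (τ' b) ω) with hU
  set W : Ω → (Fin m → S) := fun ω j => Z (τ' (b.succAbove j)) ω with hW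
  let I : Finset ℕ := insert (τ' b) (Finset.univ.image τ)
  let J : Finset ℕ := Finset.univ.image fun j => τ' (b.succAbove j)
  have hIJ : Disjoint I J := by
    rw [Finset.disjoint_right]
    intro i hi
    obtain ⟨j, -, rfl⟩ := Finset.mem_image.1 hi
    have h1 := hb _ (Fin.succAbove_ne b j)
    simp only [I, Finset.mem_insert, Finset.mem_image, Finset.mem_univ, true_and, not_or]
    exact ⟨fun h => Fin.succAbove_ne b j (hτ' h), fun ⟨a, ha⟩ => h1 ⟨a, ha⟩⟩
  have hUW : IndepFun U W P := by
    have h0 := hindep.indepFun_finset₀ I J hIJ hZ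
    have hIτ : ∀ a, τ a ∈ I := fun a => by simp [I]
    have hIb : τ' b ∈ I := by simp [I]
    have hJ : ∀ j, τ' (b.succAbove j) ∈ J := fun j => by simp [J]
    exact h0.comp (φ := fun v : I → S => ((fun a => v ⟨τ a, hIτ a⟩), v ⟨τ' b, hIb⟩))
      (ψ := fun v : J → S => fun j => v ⟨_, hJ j⟩) (by fun_prop) (by fun_prop)
  have hUm : AEMeasurable U P := (aemeasurable_pi_lambda _ fun a => hZ _).prodMk (hZ _)
  have hWm : AEMeasurable W P := aemeasurable_pi_lambda _ fun j => hZ _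
  have hWlaw : P.map W = Measure.pi fun _ => μ :=
    map_sample hindep hZ hlaw (hτ'.comp Fin.succAbove_right_injective)
  have hlawUW := hUW.map_prod_eq_prod_map_map hUm hWm
  set G : ((Fin (m + 1) → S) × S) × (Fin m → S) → ℝ :=
    fun r => g r.1.1 * g (b.insertNth r.1.2 r.2) with hG
  have hGm : Measurable G := by
    refine (hg.comp (by fun_prop)).mul (hg.comp ?_)
    exact (measurable_insertNth b).comp ((by fun_prop : Measurable fun
      r : ((Fin (m + 1) → S) × S) × (Fin m → S) => (r.1.2, r.2)))
  have e : ∀ ω, g (fun a => Z (τ a) ω) * g (fun a => Z (τ' a) ω) = G (U ω, W ω) := by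
    intro ω
    simp only [hG, hU, hW]
    congr 2
    exact (Fin.insertNth_self_removeNth b (fun a => Z (τ' a) ω)).symm
  simp_rw [e]
  rw [← integral_map (f := G) (hUm.prodMk hWm) hGm.aestronglyMeasurable, hlawUW, hWlaw]
  -- Without integrability the integral is 0 by convention, so no moment assumption is needed.
  by_cases hint : Integrable G ((P.map U).prod (Measure.pi fun _ => μ))
  swap
  · exact integral_undef hint
  rw [integral_prod _ hint]
  have hdeg' : ∀ᵐ u ∂(P.map U),
      ∫ w, g (b.insertNth u.2 w) ∂(Measure.pi fun _ : Fin m => μ) = 0 := by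
    have hs : (P.map U).map Prod.snd = μ := by
      rw [AEMeasurable.map_map_of_aemeasurable (by fun_prop) hUm, ← hlaw (τ' b)]
      rfl
    have hdeg2 : ∀ᵐ x ∂((P.map U).map Prod.snd),
        ∫ w, g (b.insertNth x w) ∂(Measure.pi fun _ : Fin m => μ) = 0 := by rwa [hs]
    exact ae_of_ae_map (by fun_prop) hdeg2
  rw [integral_congr_ae (g := 0), integral_zero']
  filter_upwards [hdeg'] with u hu
  simp only [hG, integral_const_mul, hu, mul_zero, Pi.zero_apply]

end Sample

end UStatistic

/-! ### Counting index tuples. -/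

namespace UStatistic

section Combinatorics
open Classical

/-- Sums over strictly increasing index tuples are sums over index sets. -/
lemma sum_strictMono {n k : ℕ} (F : Finset (Fin n) → ℝ) :
    ∑ τ ∈ Finset.univ.filter (fun τ : Fin k → Fin n => StrictMono τ), F (Finset.univ.image τ) =
      ∑ s ∈ Finset.powersetCard k Finset.univ, F s := by
  refine Finset.sum_nbij (fun τ => Finset.univ.image τ) ?_ ?_ ?_ fun _ _ => rfl
  · intro τ hτ
    have hτ := (Finset.mem_filter.1 hτ).2
    simp [Finset.mem_powersetCard, Finset.card_image_of_injective _ hτ.injective]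
  · intro τ hτ τ' hτ' h
    have hτ : StrictMono τ := by simpa using hτ
    have hτ' : StrictMono τ' := by simpa using hτ'
    refine (hτ.range_inj hτ').1 ?_
    have := congrArg (fun s : Finset (Fin n) => (s : Set (Fin n))) h
    simpa using this
  · intro s hs
    have hs : s.card = k := by simpa [Finset.mem_powersetCard] using hs
    refine ⟨s.orderEmbOfFin hs, by simpa using (s.orderEmbOfFin hs).strictMono, ?_⟩
    apply Finset.coe_injective
    simp

lemma card_strictMono (n k : ℕ) :
    (Finset.univ.filter (fun τ : Fin k → Fin n => StrictMono τ)).card = n.choose k := by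
  have := sum_strictMono (n := n) (k := k) fun _ => 1
  simp only [Finset.sum_const, Finset.card_powersetCard, Finset.card_univ, Fintype.card_fin,
    nsmul_eq_mul, mul_one] at this
  exact_mod_cast this

lemma card_powersetCard_mem {n k : ℕ} (i : Fin (n + 1)) :
    ((Finset.powersetCard (k + 1) Finset.univ).filter (fun s => i ∈ s)).card = n.choose k := by
  have h1 := Finset.card_filter_add_card_filter_not
    (s := Finset.powersetCard (k + 1) (Finset.univ : Finset (Fin (n + 1)))) (fun s => i ∈ s)
  have h2 : (Finset.powersetCard (k + 1) (Finset.univ : Finset (Fin (n + 1)))).filter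
      (fun s => ¬ i ∈ s) = Finset.powersetCard (k + 1) (Finset.univ.erase i) := by
    ext s
    simp only [Finset.mem_filter, Finset.mem_powersetCard, Finset.subset_univ, true_and,
      Finset.subset_erase]
    exact and_comm
  rw [h2, Finset.card_powersetCard, Finset.card_powersetCard,
    Finset.card_erase_of_mem (Finset.mem_univ _), Finset.card_univ, Fintype.card_fin,
    Nat.add_sub_cancel, Nat.choose_succ_succ'] at h1
  omega

/-- Double counting: each index lies in `n.choose k` of the subsets of size `k + 1`. -/
lemma sum_strictMono_sum {n k : ℕ} (f : Fin (n + 1) → ℝ) :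
    ∑ τ ∈ Finset.univ.filter (fun τ : Fin (k + 1) → Fin (n + 1) => StrictMono τ),
      ∑ a, f (τ a) = n.choose k * ∑ i, f i := by
  have h1 : ∀ τ ∈ Finset.univ.filter (fun τ : Fin (k + 1) → Fin (n + 1) => StrictMono τ),
      ∑ a, f (τ a) = ∑ i ∈ Finset.univ.image τ, f i := by
    intro τ hτ
    rw [Finset.sum_image fun a _ b _ h => (Finset.mem_filter.1 hτ).2.injective h]
  rw [Finset.sum_congr rfl h1, sum_strictMono fun s => ∑ i ∈ s, f i]
  have h2 : ∀ s : Finset (Fin (n + 1)), ∑ i ∈ s, f i = ∑ i, if i ∈ s then f i else 0 := by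
    intro s; simp
  simp_rw [h2]
  rw [Finset.sum_comm, Finset.mul_sum]
  refine Finset.sum_congr rfl fun i _ => ?_
  rw [← Finset.sum_filter, Finset.sum_const, card_powersetCard_mem, nsmul_eq_mul,
    if_pos (Finset.mem_univ i)]

lemma card_filter_two_values {n k : ℕ} {a b : Fin k} (hab : a ≠ b) (x y : Fin n) :
    (Finset.univ.filter (fun τ : Fin k → Fin n => τ a = x ∧ τ b = y)).card ≤ n ^ (k - 2) := by
  have hsub : Finset.univ.filter (fun τ : Fin k → Fin n => τ a = x ∧ τ b = y) ⊆
      Fintype.piFinset fun c => if c = a then {x} else if c = b then {y} else Finset.univ := by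
    intro τ hτ
    obtain ⟨h1, h2⟩ := (Finset.mem_filter.1 hτ).2
    rw [Fintype.mem_piFinset]
    intro c
    split_ifs with ha hb
    · simp [ha, h1]
    · simp [hb, h2]
    · simp
  refine (Finset.card_le_card hsub).trans ?_
  have hc : ∀ c, (if c = a then {x} else if c = b then {y} else Finset.univ :
      Finset (Fin n)).card = if c ∈ ({a, b} : Finset (Fin k)) then 1 else n := by
    intro c
    split_ifs with h1 h2 h3 h4 h5 <;> simp_all
  rw [Fintype.card_piFinset, Finset.prod_congr rfl fun c _ => hc c, Finset.prod_ite]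
  simp only [Finset.prod_const, one_pow, one_mul]
  rw [show (Finset.univ.filter fun c => ¬ c ∈ ({a, b} : Finset (Fin k))) = ({a, b} : Finset _)ᶜ by
    ext; simp, Finset.card_compl, Finset.card_pair hab, Fintype.card_fin]

/-- Few index tuples share at least two indices with a given one. -/
lemma card_overlap_le {n k : ℕ} (hk : 0 < k) (τ : Fin k → Fin n) :
    (Finset.univ.filter (fun τ' : Fin k → Fin n =>
      ¬ ∃ b, ∀ a, a ≠ b → τ' a ∉ Set.range τ)).card ≤ k ^ 4 * n ^ (k - 2) := by
  let s : Finset ((Fin k × Fin k) × (Fin k × Fin k)) := Finset.univ.filter fun r => r.1.1 ≠ r.1.2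
  let F : (Fin k × Fin k) × (Fin k × Fin k) → Finset (Fin k → Fin n) := fun r =>
    Finset.univ.filter (fun τ' => τ' r.1.1 = τ r.2.1 ∧ τ' r.1.2 = τ r.2.2)
  have hsub : Finset.univ.filter (fun τ' : Fin k → Fin n =>
      ¬ ∃ b, ∀ a, a ≠ b → τ' a ∉ Set.range τ) ⊆ s.biUnion F := by
    intro τ' hτ'
    have h := (Finset.mem_filter.1 hτ').2
    push Not at h
    -- Excluding position 0 yields a shared position `a`; excluding `a` yields a second one, `b`.
    -- The factor `k ^ 4` counts the choices of `a`, `b` and of the positions `c`, `d` they match in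
    -- `τ`.
    obtain ⟨a, -, c, hc⟩ := h ⟨0, hk⟩
    obtain ⟨b, hb, d, hd⟩ := h a
    refine Finset.mem_biUnion.2 ⟨((a, b), (c, d)), ?_, ?_⟩
    · simpa [s] using hb.symm
    · simp [F, hc, hd]
  refine (Finset.card_le_card hsub).trans ((Finset.card_biUnion_le_card_mul s F (n ^ (k - 2))
    fun r hr => card_filter_two_values (Finset.mem_filter.1 hr).2 _ _).trans ?_)
  refine Nat.mul_le_mul_right _ ((Finset.card_le_univ s).trans ?_)
  simp only [Fintype.card_prod, Fintype.card_fin]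
  exact le_of_eq (by ring)

end Combinatorics

lemma tendsto_pow_div_choose (m : ℕ) :
    Tendsto (fun n : ℕ => (n : ℝ) ^ m / (n.choose (m + 1) : ℝ)) atTop (𝓝 0) := by
  have h := (Asymptotics.IsEquivalent.refl (u := fun n : ℕ => (n : ℝ) ^ m) (l := atTop)).div
    (isEquivalent_choose (m + 1))
  refine h.symm.tendsto_nhds ?_
  have h2 : Tendsto (fun n : ℕ => ((m + 1).factorial : ℝ) * (n : ℝ)⁻¹) atTop (𝓝 0) := by
    simpa using (tendsto_inv_atTop_nhds_zero_nat (𝕜 := ℝ)).const_mul ((m + 1).factorial : ℝ)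
  refine h2.congr' ?_
  filter_upwards [eventually_gt_atTop 0] with n hn
  have : (n : ℝ) ≠ 0 := by positivity
  simp only [Pi.div_apply, pow_succ]
  field_simp

end UStatistic

/-! ### The central limit theorem for U-statistics. -/

namespace UStatistic

open Classical in
/-- The U-statistic with kernel `h` of order `k` of a sample of size `n`. -/
noncomputable def uStatistic {S : Type*} {k : ℕ} (h : (Fin k → S) → ℝ) (n : ℕ) (z : Fin n → S) :
    ℝ :=
  ((n.choose k : ℕ) : ℝ)⁻¹ *
    ∑ τ ∈ Finset.univ.filter (fun τ : Fin k → Fin n => StrictMono τ), h (fun a => z (τ a))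

section
variable {S : Type*} [MeasurableSpace S] {m : ℕ} {μ : Measure S} [IsProbabilityMeasure μ]
  {h : (Fin (m + 1) → S) → ℝ}

/-- Hoeffding's decomposition. The coefficient `(m+1)/n` is the proportion of subsets of size `m+1`
that contain a given index; `m + 1 ≤ n` keeps the binomial coefficient nonzero. -/
lemma uStatistic_sub_mean {n : ℕ} (hn : m + 1 ≤ n) (z : Fin n → S) :
    uStatistic h n z - mean μ h = uStatistic (residual μ h) n z +
      (m + 1) * (n : ℝ)⁻¹ * ∑ i, (proj μ h (z i) - mean μ h) := by
  classical
  obtain ⟨n, rfl⟩ : ∃ n', n = n' + 1 := ⟨n - 1, by omega⟩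
  have hC : (((n + 1).choose (m + 1) : ℕ) : ℝ) ≠ 0 := by
    exact_mod_cast (Nat.choose_pos hn).ne'
  have hchoose : ((n : ℝ) + 1) * n.choose m = (n + 1).choose (m + 1) * (m + 1) := by
    exact_mod_cast Nat.add_one_mul_choose_eq n m
  have hsum := sum_strictMono_sum (k := m) fun i => proj μ h (z i) - mean μ h
  simp only [uStatistic, residual, Finset.sum_sub_distrib (f := fun τ => h _ - _), hsum]
  rw [Finset.sum_sub_distrib, Finset.sum_const, card_strictMono, nsmul_eq_mul]
  have hn0 : (n : ℝ) + 1 ≠ 0 := by positivity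
  push_cast
  field_simp
  linear_combination (∑ i, (proj μ h (z i) - mean μ h)) * hchoose

end

section Sample
variable {S : Type*} [MeasurableSpace S] {k : ℕ} {μ : Measure S} [IsProbabilityMeasure μ]
  {Ω : Type*} [MeasurableSpace Ω] {P : Measure Ω} [IsProbabilityMeasure P] {Z : ℕ → Ω → S}

lemma memLp_comp_sample (hindep : iIndepFun Z P) (hZ : ∀ i, AEMeasurable (Z i) P)
    (hlaw : ∀ i, P.map (Z i) = μ) {g : (Fin k → S) → ℝ}
    (hgL : MemLp g 2 (Measure.pi fun _ => μ)) {τ : Fin k → ℕ} (hτ : Function.Injective τ) :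
    MemLp (fun ω => g (fun a => Z (τ a) ω)) 2 P := by
  rw [← map_sample hindep hZ hlaw hτ] at hgL
  exact hgL.comp_of_map (aemeasurable_pi_lambda _ fun a => hZ _)

lemma integral_sq_comp_sample (hindep : iIndepFun Z P) (hZ : ∀ i, AEMeasurable (Z i) P)
    (hlaw : ∀ i, P.map (Z i) = μ) {g : (Fin k → S) → ℝ} (hg : Measurable g)
    {τ : Fin k → ℕ} (hτ : Function.Injective τ) :
    ∫ ω, g (fun a => Z (τ a) ω) ^ 2 ∂P = ∫ z, g z ^ 2 ∂(Measure.pi fun _ => μ) := by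
  rw [← map_sample hindep hZ hlaw hτ, integral_map (aemeasurable_pi_lambda _ fun a => hZ _)
    (hg.pow_const 2).aestronglyMeasurable]

lemma integral_mul_le_integral_sq (hindep : iIndepFun Z P) (hZ : ∀ i, AEMeasurable (Z i) P)
    (hlaw : ∀ i, P.map (Z i) = μ) {g : (Fin k → S) → ℝ} (hg : Measurable g)
    (hgL : MemLp g 2 (Measure.pi fun _ => μ)) {τ τ' : Fin k → ℕ} (hτ : Function.Injective τ)
    (hτ' : Function.Injective τ') :
    ∫ ω, g (fun a => Z (τ a) ω) * g (fun a => Z (τ' a) ω) ∂P ≤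
      ∫ z, g z ^ 2 ∂(Measure.pi fun _ => μ) := by
  have h1 := memLp_comp_sample hindep hZ hlaw hgL hτ
  have h2 := memLp_comp_sample hindep hZ hlaw hgL hτ'
  have hle : ∫ ω, g (fun a => Z (τ a) ω) * g (fun a => Z (τ' a) ω) ∂P ≤
      ∫ ω, (1 / 2 * g (fun a => Z (τ a) ω) ^ 2 + 1 / 2 * g (fun a => Z (τ' a) ω) ^ 2) ∂P := by
    refine integral_mono (h1.integrable_mul h2)
      ((h1.integrable_sq.const_mul _).add (h2.integrable_sq.const_mul _)) fun ω => ?_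
    have := two_mul_le_add_sq (g fun a => Z (τ a) ω) (g fun a => Z (τ' a) ω)
    beta_reduce
    linarith
  rw [integral_add (h1.integrable_sq.const_mul _) (h2.integrable_sq.const_mul _),
    integral_const_mul, integral_const_mul, integral_sq_comp_sample hindep hZ hlaw hg hτ,
    integral_sq_comp_sample hindep hZ hlaw hg hτ'] at hle
  linarith

variable {m : ℕ}

lemma memLp_uStatistic (hindep : iIndepFun Z P) (hZ : ∀ i, AEMeasurable (Z i) P)
    (hlaw : ∀ i, P.map (Z i) = μ) {g : (Fin k → S) → ℝ}
    (hgL : MemLp g 2 (Measure.pi fun _ => μ)) (n : ℕ) :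
    MemLp (fun ω => uStatistic g n fun i => Z i ω) 2 P := by
  classical
  have hsum : MemLp (fun ω => ∑ τ ∈ Finset.univ.filter (fun τ : Fin k → Fin n => StrictMono τ),
      g (fun a => Z (τ a) ω)) 2 P := by
    refine memLp_finsetSum _ fun τ hτ => ?_
    exact memLp_comp_sample hindep hZ hlaw hgL
      (Fin.val_injective.comp (Finset.mem_filter.1 hτ).2.injective)
  exact hsum.const_mul _

/-- The second moment of a U-statistic with degenerate kernel is of order `n ^ -2`. -/
lemma integral_uStatistic_sq_le (hindep : iIndepFun Z P) (hZ : ∀ i, AEMeasurable (Z i) P)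
    (hlaw : ∀ i, P.map (Z i) = μ) {g : (Fin (m + 1) → S) → ℝ} (hg : Measurable g)
    (hgL : MemLp g 2 (Measure.pi fun _ => μ))
    (hdeg : ∀ b : Fin (m + 1),
      ∀ᵐ x ∂μ, ∫ w, g (b.insertNth x w) ∂(Measure.pi fun _ : Fin m => μ) = 0)
    {n : ℕ} (hn : m + 1 ≤ n) :
    ∫ ω, (uStatistic g n fun i => Z i ω) ^ 2 ∂P ≤
      ((n.choose (m + 1) : ℕ) : ℝ)⁻¹ * ((m + 1) ^ 4 * n ^ (m - 1)) *
        ∫ z, g z ^ 2 ∂(Measure.pi fun _ => μ) := by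
  classical
  set M := ∫ z, g z ^ 2 ∂(Measure.pi fun _ => μ) with hM
  have hM0 : 0 ≤ M := integral_nonneg fun z => sq_nonneg _
  set T := Finset.univ.filter (fun τ : Fin (m + 1) → Fin n => StrictMono τ) with hT
  let G : (Fin (m + 1) → Fin n) → Ω → ℝ := fun τ ω => g fun a => Z (τ a) ω
  have hinj : ∀ τ ∈ T, Function.Injective fun a => ((τ a : Fin n) : ℕ) := fun τ hτ =>
    Fin.val_injective.comp (Finset.mem_filter.1 hτ).2.injective
  have hGL : ∀ τ ∈ T, MemLp (G τ) 2 P := fun τ hτ =>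
    memLp_comp_sample hindep hZ hlaw hgL (hinj τ hτ)
  -- For fixed `τ` only tuples sharing at least two indices with it survive, and each such term is
  -- at most `M`.
  have hterm : ∀ τ ∈ T, ∑ τ' ∈ T, ∫ ω, G τ ω * G τ' ω ∂P ≤ (m + 1) ^ 4 * n ^ (m - 1) * M := by
    intro τ hτ
    have hle : ∀ τ' ∈ T, ∫ ω, G τ ω * G τ' ω ∂P ≤
        if ¬ ∃ b, ∀ a, a ≠ b → τ' a ∉ Set.range τ then M else 0 := by
      intro τ' hτ'
      split_ifs with hc
      · obtain ⟨b, hb⟩ := hc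
        refine le_of_eq (integral_mul_eq_zero hindep hZ hlaw hg (hdeg b) (hinj τ' hτ') ?_)
        rintro a hab ⟨c, hc⟩
        exact hb a hab ⟨c, Fin.val_injective hc⟩
      · exact integral_mul_le_integral_sq hindep hZ hlaw hg hgL (hinj τ hτ) (hinj τ' hτ')
    refine (Finset.sum_le_sum hle).trans ?_
    rw [← Finset.sum_filter, Finset.sum_const, nsmul_eq_mul]
    refine mul_le_mul_of_nonneg_right ?_ hM0
    have h1 := (Finset.card_le_card (Finset.filter_subset_filter (fun τ' : Fin (m + 1) → Fin n =>
      ¬ ∃ b, ∀ a, a ≠ b → τ' a ∉ Set.range τ) (Finset.subset_univ T))).trans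
      (card_overlap_le (Nat.succ_pos m) τ)
    rw [show m + 1 - 2 = m - 1 by omega] at h1
    exact_mod_cast h1
  have hC : (0 : ℝ) < (n.choose (m + 1) : ℕ) := by exact_mod_cast Nat.choose_pos hn
  have hexp : ∀ ω, (uStatistic g n fun i => Z i ω) ^ 2 =
      (((n.choose (m + 1) : ℕ) : ℝ)⁻¹) ^ 2 * ∑ τ ∈ T, ∑ τ' ∈ T, G τ ω * G τ' ω := by
    intro ω
    rw [uStatistic, mul_pow, sq (Finset.sum _ _), Finset.sum_mul_sum]
  simp_rw [hexp]
  have hint : ∀ τ ∈ T, ∀ τ' ∈ T, Integrable (fun ω => G τ ω * G τ' ω) P :=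
    fun τ hτ τ' hτ' => (hGL τ hτ).integrable_mul (hGL τ' hτ')
  rw [integral_const_mul, integral_finsetSum _ fun τ hτ => integrable_finsetSum _ (hint τ hτ)]
  have hs : ∑ τ ∈ T, ∫ ω, ∑ τ' ∈ T, G τ ω * G τ' ω ∂P ≤
      ∑ τ ∈ T, (((m : ℝ) + 1) ^ 4 * n ^ (m - 1) * M) := by
    refine Finset.sum_le_sum fun τ hτ => ?_
    rw [integral_finsetSum _ (hint τ hτ)]
    exact hterm τ hτ
  rw [Finset.sum_const, card_strictMono, nsmul_eq_mul] at hs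
  refine (mul_le_mul_of_nonneg_left hs (by positivity)).trans (le_of_eq ?_)
  field_simp

lemma tendsto_eLpNorm_two_zero {f : ℕ → Ω → ℝ} (hf : ∀ n, MemLp (f n) 2 P)
    (h : Tendsto (fun n => ∫ ω, f n ω ^ 2 ∂P) atTop (𝓝 0)) :
    Tendsto (fun n => eLpNorm (f n) 2 P) atTop (𝓝 0) := by
  have e : ∀ n, eLpNorm (f n) 2 P = ENNReal.ofReal ((∫ ω, f n ω ^ 2 ∂P) ^ ((2 : ℝ)⁻¹)) := by
    intro n
    rw [(hf n).eLpNorm_eq_integral_rpow_norm (by simp) (by simp)]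
    simp
  simp_rw [e]
  have h1 := (Real.continuousAt_rpow_const 0 (2 : ℝ)⁻¹ (Or.inr (by norm_num))).tendsto.comp h
  rw [Real.zero_rpow (by norm_num)] at h1
  simpa [Function.comp_def] using (ENNReal.continuous_ofReal.tendsto 0).comp h1

/-- A U-statistic with degenerate kernel is negligible at scale `√n`. -/
lemma tendstoInMeasure_sqrt_mul_uStatistic (hindep : iIndepFun Z P)
    (hZ : ∀ i, AEMeasurable (Z i) P) (hlaw : ∀ i, P.map (Z i) = μ)
    {g : (Fin (m + 2) → S) → ℝ} (hg : Measurable g) (hgL : MemLp g 2 (Measure.pi fun _ => μ))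
    (hdeg : ∀ b : Fin (m + 2),
      ∀ᵐ x ∂μ, ∫ w, g (b.insertNth x w) ∂(Measure.pi fun _ : Fin (m + 1) => μ) = 0) :
    TendstoInMeasure P (fun (n : ℕ) ω => √n * uStatistic g n fun i => Z i ω) atTop 0 := by
  have hL : ∀ n : ℕ, MemLp (fun ω => √n * uStatistic g n fun i => Z i ω) 2 P := fun n =>
    (memLp_uStatistic hindep hZ hlaw hgL n).const_mul _
  refine tendstoInMeasure_of_tendsto_eLpNorm (p := 2) (by simp)
    (fun n => (hL n).aestronglyMeasurable) aestronglyMeasurable_zero ?_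
  simp only [sub_zero]
  refine tendsto_eLpNorm_two_zero hL ?_
  set M := ∫ z, g z ^ 2 ∂(Measure.pi fun _ => μ) with hM
  -- The squared scale `n` raises the exponent to `m + 1`, one below the order `m + 2`. For a kernel
  -- of order one the truncated exponent would give a bound that does not tend to 0.
  have hlim : Tendsto (fun n : ℕ => ((m + 2 : ℕ) : ℝ) ^ 4 * M *
      ((n : ℝ) ^ (m + 1) / (n.choose (m + 1 + 1) : ℝ))) atTop (𝓝 0) := by
    simpa using (tendsto_pow_div_choose (m + 1)).const_mul (((m + 2 : ℕ) : ℝ) ^ 4 * M)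
  refine squeeze_zero' (Eventually.of_forall fun n => integral_nonneg fun ω => sq_nonneg _) ?_ hlim
  filter_upwards [eventually_ge_atTop (m + 2)] with n hn
  have h1 := integral_uStatistic_sq_le hindep hZ hlaw hg hgL hdeg hn
  simp_rw [mul_pow, Real.sq_sqrt (Nat.cast_nonneg n)]
  rw [integral_const_mul]
  refine (mul_le_mul_of_nonneg_left h1 (Nat.cast_nonneg n)).trans (le_of_eq ?_)
  rw [← hM, Nat.add_sub_cancel, pow_succ, div_eq_mul_inv]
  push_cast
  ring

/-- **Central limit theorem for U-statistics.** -/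
theorem tendstoInDistribution_uStatistic (hindep : iIndepFun Z P)
    (hZ : ∀ i, AEMeasurable (Z i) P) (hlaw : ∀ i, P.map (Z i) = μ)
    {h : (Fin (m + 2) → S) → ℝ} (hm : Measurable h)
    (hsymm : ∀ z (σ : Equiv.Perm (Fin (m + 2))), h (fun i => z (σ i)) = h z)
    (hL : MemLp h 2 (Measure.pi fun _ => μ)) (hp : MemLp (proj μ h) 2 μ)
    {Ω' : Type*} [MeasurableSpace Ω'] {Q : Measure Ω'} [IsProbabilityMeasure Q] {N : Ω' → ℝ}
    (hN : HasLaw N (gaussianReal 0 (((m + 2 : ℕ) : ℝ) ^ 2 * Var[proj μ h; μ]).toNNReal) Q) :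
    TendstoInDistribution
      (fun (n : ℕ) ω => √n * (uStatistic h n (fun i => Z i ω) - mean μ h))
      atTop N (fun _ => P) Q := by
  have hi : Integrable h (Measure.pi fun _ => μ) := hL.integrable (by norm_num)
  have hpm : Measurable (proj μ h) := measurable_proj hm
  -- With the order absorbed into `f`, the normalized sum of `f (Z i)` is exactly the linear part of
  -- the decomposition.
  let f : S → ℝ := fun x => ((m + 2 : ℕ) : ℝ) * proj μ h x
  have hf : Measurable f := hpm.const_mul _
  have hid : ∀ i, IdentDistrib (Z i) id P μ := fun i =>
    ⟨hZ i, aemeasurable_id, by rw [hlaw i, Measure.map_id]⟩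
  have hfid : ∀ i, IdentDistrib (fun ω => f (Z i ω)) f P μ := fun i => (hid i).comp hf
  have hfL : MemLp (fun ω => f (Z 0 ω)) 2 P := (hfid 0).symm.memLp_snd (hp.const_mul _)
  have hvar : Var[fun ω => f (Z 0 ω); P] = ((m + 2 : ℕ) : ℝ) ^ 2 * Var[proj μ h; μ] := by
    rw [(hfid 0).variance_eq, variance_const_mul]
  have hmean : P[fun ω => f (Z 0 ω)] = ((m + 2 : ℕ) : ℝ) * mean μ h := by
    rw [(hfid 0).integral_eq, integral_const_mul, integral_proj hi]
  have hclt := tendstoInDistribution_inv_sqrt_mul_sum_sub (X := fun i ω => f (Z i ω)) (P := P)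
    (P' := Q) (Y := N) (by rw [hvar]; exact hN) hfL (hindep.comp (fun _ => f) fun _ => hf)
    fun i => (hfid i).trans (hfid 0).symm
  -- Slutsky's lemma: the difference from the normalized sum is `√n` times the U-statistic of the
  -- residual, once `n ≥ m + 2`.
  refine tendstoInDistribution_of_tendstoInMeasure_sub _ N hclt ?_ fun n => ?_
  · have hres := tendstoInMeasure_sqrt_mul_uStatistic hindep hZ hlaw (measurable_residual hm)
      (memLp_residual hL hp) (integral_residual_insertNth hsymm hi)
    refine hres.congr' ?_ (ae_eq_refl _)
    filter_upwards [eventually_ge_atTop (m + 2)] with n hn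
    refine ae_of_all _ fun ω => ?_
    have hn0 : (0 : ℝ) < n := by exact_mod_cast (show 0 < n by omega)
    have hsq : √(n : ℝ) ≠ 0 := (Real.sqrt_pos.2 hn0).ne'
    have hdec := uStatistic_sub_mean (μ := μ) (h := h) hn fun i => Z i ω
    simp only [Pi.sub_apply, hmean, f]
    rw [hdec, Fin.sum_univ_eq_sum_range (fun i => proj μ h (Z i ω) - mean μ h),
      Finset.sum_sub_distrib, ← Finset.mul_sum, Finset.sum_const, Finset.card_range, nsmul_eq_mul]
    have hinv : √(n : ℝ) * (n : ℝ)⁻¹ = (√(n : ℝ))⁻¹ := by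
      refine eq_inv_of_mul_eq_one_left ?_
      rw [mul_right_comm, Real.mul_self_sqrt hn0.le,
        mul_inv_cancel₀ hn0.ne']
    push_cast
    linear_combination -((m : ℝ) + 2) *
      (∑ i ∈ Finset.range n, proj μ h (Z i ω) - n * mean μ h) * hinv
  · exact (((memLp_uStatistic hindep hZ hlaw hL n).sub (memLp_const _)).const_mul
      _).aestronglyMeasurable.aemeasurable

end Sample

end UStatistic

/-! ### Application to the distance covariance kernel. -/

theorem mainTheorem5 {p q : ℕ}
    {Ω : Type*} [MeasurableSpace Ω] (P : Measure Ω) [IsProbabilityMeasure P]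
    (X : Ω → EuclideanSpace ℝ (Fin p)) (Y : Ω → EuclideanSpace ℝ (Fin q))
    (hX : Measurable X) (hY : Measurable Y)
    -- finite first moments
    (hX1 : Integrable X P) (hY1 : Integrable Y P)
    -- the kernel has a finite second moment under four independent copies of `(X, Y)`
    (hker : MemLp (DistCov.kernel (p := p) (q := q)) 2
      (Measure.pi fun _ : Fin 4 => P.map (fun ω => (X ω, Y ω))))
    -- `0 < Var(h₁(X,Y)) < ∞`
    (hvar_pos : 0 < evariance
      (fun ω => DistCov.kernelProj (P.map (fun ω => (X ω, Y ω))) (X ω, Y ω)) P)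
    (hvar_fin : evariance
      (fun ω => DistCov.kernelProj (P.map (fun ω => (X ω, Y ω))) (X ω, Y ω)) P < ∞)
    -- a random sample from `(X, Y)`
    {Ω' : Type*} [MeasurableSpace Ω'] (P' : Measure Ω') [IsProbabilityMeasure P']
    (Xs : ℕ → Ω' → EuclideanSpace ℝ (Fin p)) (Ys : ℕ → Ω' → EuclideanSpace ℝ (Fin q))
    (hindep : iIndepFun (fun i ω => (Xs i ω, Ys i ω)) P')
    (hident : ∀ i, IdentDistrib (fun ω => (Xs i ω, Ys i ω)) (fun ω => (X ω, Y ω)) P' P)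
    -- a centred normal variable with variance `16 Var(h₁(X,Y))`
    {Ω'' : Type*} [MeasurableSpace Ω''] (Q : Measure Ω'') [IsProbabilityMeasure Q]
    (Z : Ω'' → ℝ)
    (hZ : HasLaw Z (gaussianReal 0 (16 * variance
      (fun ω => DistCov.kernelProj (P.map (fun ω => (X ω, Y ω))) (X ω, Y ω)) P).toNNReal) Q) :
    DistCov.dcovSq P X Y < ∞ ∧
    TendstoInDistribution
      (fun (n : ℕ) (ω : Ω') => Real.sqrt n *
        (DistCov.uStat n (fun i => (Xs i ω, Ys i ω)) - (DistCov.dcovSq P X Y).toReal))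
      atTop Z (fun _ => P') Q := by
  have hXY : AEMeasurable (fun ω => (X ω, Y ω)) P := (hX.prodMk hY).aemeasurable
  obtain ⟨hfin, hθ⟩ := DistCov.dcovSq_eq_integral_kernel P X Y hX hY hX1 hY1
  refine ⟨hfin, ?_⟩
  rw [hθ]
  have hμ : IsProbabilityMeasure (P.map fun ω => (X ω, Y ω)) :=
    Measure.isProbabilityMeasure_map hXY
  have hproj : Measurable
      (DistCov.kernelProj (p := p) (q := q) (P.map fun ω => (X ω, Y ω))) :=
    UStatistic.measurable_proj DistCov.measurable_kernel
  have hp : MemLp (DistCov.kernelProj (P.map fun ω => (X ω, Y ω))) 2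
      (P.map fun ω => (X ω, Y ω)) :=
    (memLp_map_measure_iff hproj.aestronglyMeasurable hXY).2
      ((evariance_lt_top_iff_memLp (hproj.comp_aemeasurable hXY).aestronglyMeasurable).1 hvar_fin)
  have hvar : Var[DistCov.kernelProj (P.map fun ω => (X ω, Y ω)); P.map fun ω => (X ω, Y ω)] =
      Var[fun ω => DistCov.kernelProj (P.map fun ω => (X ω, Y ω)) (X ω, Y ω); P] :=
    variance_map hproj.aemeasurable hXY
  -- Order 4 is `m = 2`. By unfolding, `uStat`, `kernelProj` and the integral of `kernel` are
  -- `uStatistic`, `proj` and `mean` of `kernel`.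
  refine UStatistic.tendstoInDistribution_uStatistic (m := 2)
    (Z := fun i ω => (Xs i ω, Ys i ω)) hindep (fun i => (hident i).aemeasurable_fst)
    (fun i => (hident i).map_eq) DistCov.measurable_kernel DistCov.kernel_comp_perm hker hp ?_
  have h16 : ((2 + 2 : ℕ) : ℝ) ^ 2 * Var[UStatistic.proj (P.map fun ω => (X ω, Y ω))
      (DistCov.kernel (p := p) (q := q)); P.map fun ω => (X ω, Y ω)] =
      16 * Var[fun ω => DistCov.kernelProj (P.map fun ω => (X ω, Y ω)) (X ω, Y ω); P] := by
    rw [← hvar]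
    norm_num
    rfl
  rw [h16]
  exact hZ
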